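/- Let $k\ge 1$ be odd, let $M$ be a smooth manifold of (even) dimension $k+1$, let $E\to M$ be a smooth real vector bundle of rank $2$, and let $TM\simeq S^k(E)$ be a $GL(2)$-structure, i.e. a smooth isomorphism of vector bundles. Let $\pi\colon B(E)\to M$ be the principal $GL(2)$-bundle of frames $(x,y)$ of $E$, with right action $(x,y)\mapsto(x,y)g$ (since $k$ is odd, it is the same as the bundle of the frames $(x^k,x^{k-1}y,\ldots,y^k)$ of $TM$). Let $\mathbb V[k]$ be the space of real homogeneous polynomials of degree $k$ in $x,y$, and let $\omega=(\omega^0,\ldots,\omega^k)$ be the $\mathbb V[k]$-valued soldering form on $B(E)$: at a frame $(x,y)$ one has $d\pi(v)=\sum_i\omega^i(v)\,x^{k-i}y^i$ in $TM\simeq S^k(E)$. The polynomials $V^{even}_{k,j}=(x^2+y^2)^j\,\mathrm{Re}\,(x+\mathrm iy)^{k-2j}$ and $V^{odd}_{k,j}=(x^2+y^2)^j\,\mathrm{Im}\,(x+\mathrm iy)^{k-2j}$, $j=0,\ldots,\lfloor k/2\rfloor$, form a basis of $\mathbb V[k]$; let $\xi^{k,j}_{even},\xi^{k,j}_{odd}$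 be the dual basis, and let $\xi^{k,j}=\xi^{k,j}_{even}+\mathrm i\,\xi^{k,j}_{odd}$, regarded through $\omega$ as complex-valued horizontal $1$-forms on $B(E)$. Let $CO(2)\subset GL(2)$ be the subgroup of the matrices $\begin{pmatrix}u&-v\\v&u\end{pmatrix}$ with $u^2+v^2\ne0$. Let a $GL(2)$-connection on $B(E)$ be given by a smooth $1$-form $\phi=\begin{pmatrix}\phi^1_1&\phi^2_1\\ \phi^1_2&\phi^2_2\end{pmatrix}$ with values in $\mathfrak{gl}(2)$, and put $\zeta=(\phi^1_2+\phi^2_1)+\mathrm i(\phi^2_2-\phi^1_1)$. Then the quotient $B(E)/CO(2)$, with its quotient topology, is a smooth manifold of dimension $k+3$ for which the projection $q\colon B(E)\to B(E)/CO(2)$ is a smooth submersion, and it carries a canonical almost-complex structure $\mathfrak J_\phi$: there is exactly one smooth almost-complex structure on $B(E)/CO(2)$ such that at every point $b\in B(E)$ the pullbacks along $q$ of the $(1,0)$-forms at $q(b)$ are exactly the complex linear combinations of $\xi^{k,0},\ldots,\xi^{k,\lfloor k/2\rfloor}$ and $\zeta$ at $b$. -/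

import Mathlib

noncomputable section
namespace GL2Geometry
open scoped Manifold ContDiff Bundle
open Bundle MvPolynomial

/-- The space `V[k]` of homogeneous polynomials of degree `k` in the variables `x = X 0`, `y = X 1`. -/
abbrev V (k : ℕ) : Submodule ℝ (MvPolynomial (Fin 2) ℝ) := homogeneousSubmodule (Fin 2) ℝ k

/-- `W_i^even = Re (x + iy)^i`. -/
def Weven (i : ℕ) : MvPolynomial (Fin 2) ℝ :=
  ∑ s ∈ Finset.range (i / 2 + 1),
    C ((-1) ^ s * (i.choose (2 * s) : ℝ)) * X 0 ^ (i - 2 * s) * X 1 ^ (2 * s)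

/-- `W_i^odd = Im (x + iy)^i`. (For `i = 0` the only summand has coefficient `choose 0 1 = 0`.) -/
def Wodd (i : ℕ) : MvPolynomial (Fin 2) ℝ :=
  ∑ s ∈ Finset.range ((i - 1) / 2 + 1),
    C ((-1) ^ s * (i.choose (2 * s + 1) : ℝ)) * X 0 ^ (i - 2 * s - 1) * X 1 ^ (2 * s + 1)

/-- `V_{k,j}^even = (x² + y²)^j W_{k-2j}^even`, used for `2j ≤ k`. -/
def Veven (k j : ℕ) : MvPolynomial (Fin 2) ℝ := (X 0 ^ 2 + X 1 ^ 2) ^ j * Weven (k - 2 * j)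

/-- `V_{k,j}^odd = (x² + y²)^j W_{k-2j}^odd`, used for `2j ≤ k`. -/
def Vodd (k j : ℕ) : MvPolynomial (Fin 2) ℝ := (X 0 ^ 2 + X 1 ^ 2) ^ j * Wodd (k - 2 * j)

theorem Weven_mem (i : ℕ) : Weven i ∈ V i := by
  refine Submodule.sum_mem _ fun s hs => ?_
  have h : 2 * s ≤ i := by have := Finset.mem_range.mp hs; omega
  have := ((isHomogeneous_C_mul_X_pow ((-1) ^ s * (i.choose (2 * s) : ℝ)) (0 : Fin 2)
    (i - 2 * s)).mul (isHomogeneous_X_pow (R := ℝ) (1 : Fin 2) (2 * s)))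
  rwa [Nat.sub_add_cancel h] at this

theorem Wodd_mem (i : ℕ) : Wodd i ∈ V i := by
  refine Submodule.sum_mem _ fun s hs => ?_
  rcases Nat.lt_or_ge i (2 * s + 1) with h | h
  · simp [Nat.choose_eq_zero_of_lt h]
  · have := ((isHomogeneous_C_mul_X_pow ((-1) ^ s * (i.choose (2 * s + 1) : ℝ)) (0 : Fin 2)
      (i - 2 * s - 1)).mul (isHomogeneous_X_pow (R := ℝ) (1 : Fin 2) (2 * s + 1)))
    rwa [show i - 2 * s - 1 + (2 * s + 1) = i by omega] at this

theorem sq_mem (j : ℕ) : ((X 0 ^ 2 + X 1 ^ 2) ^ j : MvPolynomial (Fin 2) ℝ) ∈ V (2 * j) :=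
  ((isHomogeneous_X_pow (R := ℝ) (0 : Fin 2) 2).add (isHomogeneous_X_pow 1 2)).pow j

theorem Veven_mem {k j : ℕ} (h : 2 * j ≤ k) : Veven k j ∈ V k := by
  have := IsHomogeneous.mul (sq_mem j) (Weven_mem (k - 2 * j))
  rwa [Nat.add_sub_cancel' h] at this

theorem Vodd_mem {k j : ℕ} (h : 2 * j ≤ k) : Vodd k j ∈ V k := by
  have := IsHomogeneous.mul (sq_mem j) (Wodd_mem (k - 2 * j))
  rwa [Nat.add_sub_cancel' h] at this

/-- `W_n^even + i W_n^odd = (x + iy)^n`, in any commutative algebra with a square root of `-1`. -/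
theorem aeval_W {A : Type*} [CommRing A] [Algebra ℝ A] (ι x y : A) (hι : ι ^ 2 = -1) (n : ℕ) :
    aeval ![x, y] (Weven n) + ι * aeval ![x, y] (Wodd n) = (x + ι * y) ^ n := by
  set f : ℕ → A := fun m => x ^ (n - m) * (ι * y) ^ m * (n.choose m : A) with hf
  have hf0 : ∀ m, n < m → f m = 0 := fun m hm => by simp [hf, Nat.choose_eq_zero_of_lt hm]
  have key : ∀ N, ∑ m ∈ Finset.range (2 * N), f m
      = ∑ s ∈ Finset.range N, f (2 * s) + ∑ s ∈ Finset.range N, f (2 * s + 1) := by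
    intro N
    induction N with
    | zero => simp
    | succ N ih =>
      rw [show 2 * (N + 1) = 2 * N + 1 + 1 by ring]
      simp only [Finset.sum_range_succ, ih]
      ring
  have hsub : ∀ (g : ℕ → A) (a b : ℕ), a ≤ b → (∀ m, a ≤ m → g m = 0) →
      ∑ s ∈ Finset.range b, g s = ∑ s ∈ Finset.range a, g s := by
    intro g a b hab h0
    refine (Finset.sum_subset (Finset.range_mono hab) fun m _ hm => h0 m ?_).symm
    simpa using hm
  have hp : ∀ s, ι ^ (2 * s) = (-1) ^ s := fun s => by rw [pow_mul, hι]
  rw [add_comm x, add_pow]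
  have e0 : ∑ m ∈ Finset.range (n + 1), (ι * y) ^ m * x ^ (n - m) * (n.choose m : A)
      = ∑ m ∈ Finset.range (2 * (n + 1)), f m := by
    rw [hsub f (n + 1) (2 * (n + 1)) (by omega) (fun m hm => hf0 m (by omega))]
    exact Finset.sum_congr rfl fun m _ => by simp only [hf]; ring
  rw [e0, key, hsub (fun s => f (2 * s)) (n / 2 + 1) (n + 1) (by omega)
      (fun m hm => hf0 _ (by omega)),
    hsub (fun s => f (2 * s + 1)) ((n - 1) / 2 + 1) (n + 1) (by omega)
      (fun m hm => hf0 _ (by omega))]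
  simp only [Weven, Wodd, map_sum, Finset.mul_sum]
  congr 1
  · refine Finset.sum_congr rfl fun s _ => ?_
    simp only [hf, map_mul, map_pow, aeval_X, Matrix.cons_val_zero, Matrix.cons_val_one,
      mul_pow, hp, map_neg, map_one, map_natCast]
    ring
  · refine Finset.sum_congr rfl fun s _ => ?_
    simp only [hf, map_mul, map_pow, aeval_X, Matrix.cons_val_zero, Matrix.cons_val_one,
      mul_pow, pow_succ, hp, map_neg, map_one, map_natCast, Nat.sub_sub]
    ring

/-- The index set `j = 0, …, ⌊k/2⌋`. -/
abbrev Idx (k : ℕ) : Type := Fin (k / 2 + 1)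

/-- The family `V_{k,j}^even` (left summand), `V_{k,j}^odd` (right summand). -/
def adaptedFamily (k : ℕ) : Idx k ⊕ Idx k → V k :=
  Sum.elim (fun j => ⟨Veven k j, Veven_mem (by have := j.2; omega)⟩)
    (fun j => ⟨Vodd k j, Vodd_mem (by have := j.2; omega)⟩)

theorem finrank_V (k : ℕ) : Module.finrank ℝ (V k) = k + 1 := by
  have e : V k ≃ₗ[ℝ] ({d : Fin 2 →₀ ℕ | d.degree = k} →₀ ℝ) :=
    (LinearEquiv.ofEq _ _ (homogeneousSubmodule_eq_finsupp_supported (Fin 2) ℝ k)).trans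
      (AddMonoidAlgebra.supportedEquivFinsupp _)
  have e2 : {d : Fin 2 →₀ ℕ | d.degree = k} ≃ Fin (k + 1) :=
    { toFun := fun d => ⟨d.1 0, by
        have := d.2
        simp only [Set.mem_ofPred_eq, Finsupp.degree_eq_sum, Fin.sum_univ_two] at this
        omega⟩
      invFun := fun i => ⟨Finsupp.equivFunOnFinite.symm ![i, k - i], by
        simp only [Set.mem_ofPred_eq, Finsupp.degree_eq_sum, Fin.sum_univ_two]
        simp; omega⟩
      left_inv := fun d => by
        have := d.2
        simp only [Set.mem_ofPred_eq, Finsupp.degree_eq_sum, Fin.sum_univ_two] at this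
        ext a
        fin_cases a
        · simp
        · simp; omega
      right_inv := fun i => by simp }
  rw [(e.trans (Finsupp.domLCongr e2)).finrank_eq]
  simp

theorem adaptedFamily_li {k : ℕ} (hk : Odd k) : LinearIndependent ℝ (adaptedFamily k) := by
  set ι : MvPolynomial (Fin 2) ℂ := C Complex.I with hι
  have hι2 : ι ^ 2 = -1 := by rw [hι, ← map_pow, Complex.I_sq]; simp
  have hhalf : (C (1 / 2 : ℂ) : MvPolynomial (Fin 2) ℂ) * 2 = 1 := by
    rw [show (2 : MvPolynomial (Fin 2) ℂ) = C 2 from (map_ofNat C 2).symm, ← map_mul]; norm_num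
  set h : MvPolynomial (Fin 2) ℂ := C (1 / 2 : ℂ) with hh
  set x : MvPolynomial (Fin 2) ℂ := h * (X 0 + X 1) with hx
  set y : MvPolynomial (Fin 2) ℂ := - ι * h * (X 0 - X 1) with hy
  have ea : x + ι * y = X 0 := by
    rw [hx, hy]; linear_combination (-(h * (X 0 - X 1))) * hι2 + X 0 * hhalf
  have eb : x + (-ι) * y = X 1 := by
    rw [hx, hy]; linear_combination ((h * (X 0 - X 1))) * hι2 + X 1 * hhalf
  have exy : x ^ 2 + y ^ 2 = X 0 * X 1 := by
    rw [← ea, ← eb]; linear_combination (y ^ 2) * hι2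
  set θ := aeval (R := ℝ) ![x, y] with hθ
  have hA : ∀ n, θ (Weven n) + ι * θ (Wodd n) = X 0 ^ n := fun n => by
    rw [hθ, aeval_W ι x y hι2, ea]
  have hB : ∀ n, θ (Weven n) - ι * θ (Wodd n) = X 1 ^ n := fun n => by
    have := aeval_W (-ι) x y (by rw [neg_sq, hι2]) n
    rw [eb] at this
    rw [← this, hθ]; ring
  have hE : ∀ n, θ (Weven n) = h * (X 0 ^ n + X 1 ^ n) := fun n => by
    linear_combination (h) * hA n + h * hB n - θ (Weven n) * hhalf
  have hO : ∀ n, θ (Wodd n) = - ι * h * (X 0 ^ n - X 1 ^ n) := fun n => by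
    linear_combination (-ι * h) * hA n + ι * h * hB n
      - θ (Wodd n) * hhalf + 2 * h * θ (Wodd n) * hι2
  have hsq : θ (X 0 ^ 2 + X 1 ^ 2) = X 0 * X 1 := by
    rw [← exy, hθ]; simp
  rw [Fintype.linearIndependent_iff]
  intro g hg
  have h1 : ∑ j : Idx k, (C ((g (Sum.inl j) : ℂ)) * θ (Veven k j)
      + C ((g (Sum.inr j) : ℂ)) * θ (Vodd k j)) = 0 := by
    have h2 := congrArg (fun p : V k => θ p.1) hg
    simp only [Fintype.sum_sum_type] at h2
    simp only [adaptedFamily, Sum.elim_inl, Sum.elim_inr, Submodule.coe_add, map_add,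
      AddSubmonoidClass.coe_finsetSum, Submodule.coe_smul, map_sum, map_smul] at h2
    rw [Finset.sum_add_distrib]
    simpa [Algebra.smul_def, MvPolynomial.algebraMap_eq, IsScalarTower.algebraMap_apply ℝ ℂ
      (MvPolynomial (Fin 2) ℂ)] using h2
  have h3 : ∀ j : Idx k, C ((g (Sum.inl j) : ℂ)) * θ (Veven k j)
      + C ((g (Sum.inr j) : ℂ)) * θ (Vodd k j)
      = monomial (Finsupp.equivFunOnFinite.symm ![k - (j : ℕ), (j : ℕ)])
          ((g (Sum.inl j) - g (Sum.inr j) * Complex.I) / 2 : ℂ)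
        + monomial (Finsupp.equivFunOnFinite.symm ![(j : ℕ), k - (j : ℕ)])
          ((g (Sum.inl j) + g (Sum.inr j) * Complex.I) / 2 : ℂ) := by
    intro j
    have hmon : ∀ (a b : ℕ) (c : ℂ), monomial (Finsupp.equivFunOnFinite.symm ![a, b]) c
        = C c * (X 0 ^ a * X 1 ^ b : MvPolynomial (Fin 2) ℂ) := by
      intro a b c
      rw [MvPolynomial.monomial_eq, Finsupp.prod_fintype _ _ (by simp)]
      simp [Fin.prod_univ_two]
    have hj : 2 * (j : ℕ) ≤ k := by have := j.2; omega
    obtain ⟨m, hm⟩ := Nat.exists_eq_add_of_le hj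
    have c1 : k - 2 * (j : ℕ) = m := by omega
    have c2 : k - (j : ℕ) = j + m := by omega
    rw [hmon, hmon, Veven, Vodd, map_mul, map_mul, map_pow, hsq, hE, hO, c1, c2]
    have d1 : (C ((g (Sum.inl j) - g (Sum.inr j) * Complex.I) / 2 : ℂ) : MvPolynomial (Fin 2) ℂ)
        = (C (g (Sum.inl j) : ℂ) - C (g (Sum.inr j) : ℂ) * ι) * h := by
      rw [hι, hh, ← map_mul, ← map_sub, ← map_mul]; congr 1; ring
    have d2 : (C ((g (Sum.inl j) + g (Sum.inr j) * Complex.I) / 2 : ℂ) : MvPolynomial (Fin 2) ℂ)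
        = (C (g (Sum.inl j) : ℂ) + C (g (Sum.inr j) : ℂ) * ι) * h := by
      rw [hι, hh, ← map_mul, ← map_add, ← map_mul]; congr 1; ring
    rw [d1, d2]
    ring
  have h4 : ∀ i : Idx k, (g (Sum.inl i) - g (Sum.inr i) * Complex.I) / 2 = (0 : ℂ) := by
    intro i
    have hco := congrArg (coeff (Finsupp.equivFunOnFinite.symm ![k - (i : ℕ), (i : ℕ)])) h1
    simp only [h3, coeff_sum, coeff_add, coeff_monomial, coeff_zero] at hco
    rw [Finset.sum_eq_single i] at hco
    · have : ¬ (Finsupp.equivFunOnFinite.symm ![(i : ℕ), k - (i : ℕ)]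
          = Finsupp.equivFunOnFinite.symm ![k - (i : ℕ), (i : ℕ)]) := by
        intro he
        have := congrFun (Finsupp.equivFunOnFinite.symm.injective he) 0
        simp at this
        have := i.2
        obtain ⟨r, hr⟩ := hk
        omega
      simpa [this] using hco
    · intro b _ hb
      have n1 : ¬ (Finsupp.equivFunOnFinite.symm ![k - (b : ℕ), (b : ℕ)]
          = Finsupp.equivFunOnFinite.symm ![k - (i : ℕ), (i : ℕ)]) := by
        intro he
        have := congrFun (Finsupp.equivFunOnFinite.symm.injective he) 1
        simp at this
        exact hb (Fin.ext this)
      have n2 : ¬ (Finsupp.equivFunOnFinite.symm ![(b : ℕ), k - (b : ℕ)]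
          = Finsupp.equivFunOnFinite.symm ![k - (i : ℕ), (i : ℕ)]) := by
        intro he
        have := congrFun (Finsupp.equivFunOnFinite.symm.injective he) 0
        simp at this
        have := i.2
        have := b.2
        obtain ⟨r, hr⟩ := hk
        omega
      simp [n1, n2]
    · simp
  rintro (i | i)
  · have := congrArg Complex.re (h4 i)
    simpa using this
  · have := congrArg Complex.im (h4 i)
    simpa using this

/-- For `k` odd the polynomials `V_{k,j}^even`, `V_{k,j}^odd` form a basis of `V[k]`. -/
def adaptedBasis {k : ℕ} (hk : Odd k) : Module.Basis (Idx k ⊕ Idx k) ℝ (V k) :=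
  basisOfLinearIndependentOfCardEqFinrank (adaptedFamily_li hk) (by
    rw [finrank_V]; obtain ⟨r, rfl⟩ := hk; simp; omega)

/-- `ξ^{k,j} = ξ^{k,j}_even + i ξ^{k,j}_odd : V[k] → ℂ`, where `ξ^{k,j}_even`, `ξ^{k,j}_odd` is the
dual basis of `V_{k,j}^even`, `V_{k,j}^odd`. -/
def xiV {k : ℕ} (hk : Odd k) (j : Idx k) : V k →ₗ[ℝ] ℂ :=
  Complex.ofRealAm.toLinearMap ∘ₗ (adaptedBasis hk).coord (Sum.inl j)
    + Complex.I • (Complex.ofRealAm.toLinearMap ∘ₗ (adaptedBasis hk).coord (Sum.inr j))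

variable {W : Type*} [AddCommGroup W] [Module ℝ W]

/-- The symmetric power `S^k(W)`: the degree `k` part of the symmetric algebra of `W`, that is
the span of the products of `k` elements of `W`. -/
abbrev SymPow (k : ℕ) (W : Type*) [AddCommGroup W] [Module ℝ W] :
    Submodule ℝ (SymmetricAlgebra ℝ W) :=
  LinearMap.range (SymmetricAlgebra.ι ℝ W) ^ k

theorem prod_mem_symPow {k : ℕ} (w : Fin k → W) :
    ∏ i, SymmetricAlgebra.ι ℝ W (w i) ∈ SymPow k W := by
  induction k with
  | zero => simp [SymPow, Submodule.mem_one]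
  | succ k ih =>
    rw [Fin.prod_univ_castSucc, SymPow, pow_succ]
    exact Submodule.mul_mem_mul (ih _) (LinearMap.mem_range_self _ _)

/-- The symmetric product `w_1 ⊙ … ⊙ w_k`, as an element of `S^k(W)`. -/
def symProd {k : ℕ} (w : Fin k → W) : SymPow k W :=
  ⟨∏ i, SymmetricAlgebra.ι ℝ W (w i), prod_mem_symPow w⟩

theorem map_equivMvPolynomial (k : ℕ) (b : Module.Basis (Fin 2) ℝ W) :
    (SymPow k W).map (SymmetricAlgebra.equivMvPolynomial b).toLinearMap = V k := by
  have h : (SymPow k W).map (SymmetricAlgebra.equivMvPolynomial b).toAlgHom.toLinearMap = V k := by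
    rw [Submodule.map_pow, V, ← homogeneousSubmodule_one_pow, homogeneousSubmodule_one_eq_span_X]
    congr 1
    rw [LinearMap.range_eq_map, ← b.span_eq, ← Submodule.map_comp, Submodule.map_span]
    congr 1
    ext p
    simp
  exact h

/-- A basis `(x, y)` of `W` identifies `S^k(W)` with the homogeneous polynomials `V[k]`. -/
def polyEquiv (k : ℕ) (b : Module.Basis (Fin 2) ℝ W) : SymPow k W ≃ₗ[ℝ] V k :=
  ((SymmetricAlgebra.equivMvPolynomial b).toLinearEquiv.submoduleMap (SymPow k W)).trans
    (LinearEquiv.ofEq _ _ (map_equivMvPolynomial k b))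


section Geometry

/-- The model fibre of a vector bundle of rank 2. -/
abbrev F2 : Type := EuclideanSpace ℝ (Fin 2)

section Frames

variable {M : Type*} [TopologicalSpace M] (E : M → Type*) [∀ p, AddCommGroup (E p)]
  [∀ p, Module ℝ (E p)] [∀ p, TopologicalSpace (E p)] [TopologicalSpace (TotalSpace F2 E)]
  [FiberBundle F2 E] [VectorBundle ℝ F2 E]

/-- The frames `(x, y)` of the rank 2 bundle `E`, an open subset of the total space of `E ⊕ E`. -/
def frameOpens : TopologicalSpace.Opens (TotalSpace (F2 × F2) (E ×ᵇ E)) where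
  carrier := {b | LinearIndependent ℝ ![b.2.1, b.2.2]}
  is_open' := by
    rw [isOpen_iff_mem_nhds]
    intro b hb
    set e := trivializationAt F2 E b.proj with he
    have key : ∀ c : TotalSpace (F2 × F2) (E ×ᵇ E), c.proj ∈ e.baseSet →
        (LinearIndependent ℝ ![(e.prod e c).2.1, (e.prod e c).2.2] ↔
          LinearIndependent ℝ ![c.2.1, c.2.2]) := by
      intro c hc
      have h1 : ![(e.prod e c).2.1, (e.prod e c).2.2]
          = (e.linearEquivAt ℝ c.proj hc : E c.proj → F2) ∘ ![c.2.1, c.2.2] := by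
        funext i; fin_cases i <;> rfl
      rw [h1]
      exact LinearMap.linearIndependent_iff (e.linearEquivAt ℝ c.proj hc).toLinearMap
        (e.linearEquivAt ℝ c.proj hc).ker
    have hmem : b ∈ (e.prod e).source := by
      rw [Trivialization.mem_source]
      exact ⟨mem_baseSet_trivializationAt F2 E b.proj, mem_baseSet_trivializationAt F2 E b.proj⟩
    have hO : IsOpen {f : Fin 2 → F2 | LinearIndependent ℝ f} := isOpen_setOfPred_linearIndependent
    have hct : ContinuousAt (fun c => ![(e.prod e c).2.1, (e.prod e c).2.2]) b := by
      have h0 : ContinuousAt (e.prod e) b := (e.prod e).continuousAt hmem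
      refine continuousAt_pi.2 fun i => ?_
      fin_cases i
      · exact h0.snd.fst
      · exact h0.snd.snd
    have h2 := hct.preimage_mem_nhds
      (hO.mem_nhds ((key b (mem_baseSet_trivializationAt F2 E b.proj)).2 hb))
    filter_upwards [h2, (e.prod e).open_source.mem_nhds hmem] with c hc hc'
    rw [Trivialization.mem_source] at hc'
    exact (key c hc'.1).1 hc

/-- The bundle `B(E)` of frames `(x, y)` of `E`, with the smooth structure of an open subset of
`E ⊕ E`. When `TM ≅ S^k(E)` with `k` odd, a frame `(x, y)` is the same thing as the frame
`(x^k, x^{k-1} y, …, y^k)` of `TM`. -/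
abbrev FrameBundle : Type _ := frameOpens E

variable {E}

/-- The first vector `x` of the frame. -/
def FrameBundle.fst (b : FrameBundle E) : E b.1.proj := b.1.2.1
/-- The second vector `y` of the frame. -/
def FrameBundle.snd (b : FrameBundle E) : E b.1.proj := b.1.2.2

theorem finrank_fiber (E : M → Type*) [∀ p, AddCommGroup (E p)]
    [∀ p, Module ℝ (E p)] [∀ p, TopologicalSpace (E p)] [TopologicalSpace (TotalSpace F2 E)]
    [FiberBundle F2 E] [VectorBundle ℝ F2 E] (p : M) : Module.finrank ℝ (E p) = 2 := by
  have := ((trivializationAt F2 E p).linearEquivAt ℝ p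
    (mem_baseSet_trivializationAt F2 E p)).finrank_eq
  rw [this]; simp

/-- The frame `(x, y)` as a basis of the fibre. -/
def FrameBundle.basis (b : FrameBundle E) : Module.Basis (Fin 2) ℝ (E b.1.proj) :=
  basisOfLinearIndependentOfCardEqFinrank (b := ![b.fst, b.snd]) b.2
    (by rw [finrank_fiber]; simp)

/-- The right action of `GL(2)` on frames, `(x, y) ↦ (x, y) g`. -/
def FrameBundle.act (b : FrameBundle E) (g : GL (Fin 2) ℝ) : FrameBundle E :=
  ⟨⟨b.1.proj, (g 0 0 • b.fst + g 1 0 • b.snd, g 0 1 • b.fst + g 1 1 • b.snd)⟩, by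
    have hdet : g 0 0 * g 1 1 - g 1 0 * g 0 1 ≠ 0 := by
      have := g.det.ne_zero
      rw [Matrix.GeneralLinearGroup.val_det_apply, Matrix.det_fin_two] at this
      intro h; apply this; linear_combination h
    have hb : LinearIndependent ℝ ![b.fst, b.snd] := b.2
    change LinearIndependent ℝ ![_, _]
    rw [LinearIndependent.pair_iff] at hb ⊢
    intro s t hst
    obtain ⟨h1, h2⟩ := hb (s * g 0 0 + t * g 0 1) (s * g 1 0 + t * g 1 1) (by
      rw [← hst]; module)
    constructor
    · apply (mul_eq_zero.1 (?_ : (g 0 0 * g 1 1 - g 1 0 * g 0 1) * s = 0)).resolve_left hdet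
      linear_combination g 1 1 * h1 - g 0 1 * h2
    · apply (mul_eq_zero.1 (?_ : (g 0 0 * g 1 1 - g 1 0 * g 0 1) * t = 0)).resolve_left hdet
      linear_combination g 0 0 * h2 - g 1 0 * h1⟩

theorem FrameBundle.act_one (b : FrameBundle E) : b.act 1 = b := by
  obtain ⟨⟨p, x, y⟩, hb⟩ := b
  simp [FrameBundle.act, FrameBundle.fst, FrameBundle.snd]

theorem FrameBundle.act_mul (b : FrameBundle E) (g h : GL (Fin 2) ℝ) :
    b.act (g * h) = (b.act g).act h := by
  obtain ⟨⟨p, x, y⟩, hb⟩ := b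
  apply Subtype.ext
  simp only [FrameBundle.act, FrameBundle.fst, FrameBundle.snd, Units.val_mul, Matrix.mul_apply,
    Fin.sum_univ_two]
  congr 1
  refine Prod.ext ?_ ?_
  · change (g 0 0 * h 0 0 + g 0 1 * h 1 0) • x + (g 1 0 * h 0 0 + g 1 1 * h 1 0) • y
      = h 0 0 • (g 0 0 • x + g 1 0 • y) + h 1 0 • (g 0 1 • x + g 1 1 • y)
    module
  · change (g 0 0 * h 0 1 + g 0 1 * h 1 1) • x + (g 1 0 * h 0 1 + g 1 1 * h 1 1) • y
      = h 0 1 • (g 0 0 • x + g 1 0 • y) + h 1 1 • (g 0 1 • x + g 1 1 • y)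
    module

/-- `CO(2)`, the subgroup of the matrices `(u, -v; v, u)`; `u² + v² ≠ 0` by invertibility. -/
def CO2 : Subgroup (GL (Fin 2) ℝ) where
  carrier := {g | ∃ u v : ℝ, (g : Matrix (Fin 2) (Fin 2) ℝ) = !![u, -v; v, u]}
  one_mem' := ⟨1, 0, by simp [Matrix.one_fin_two]⟩
  mul_mem' := by
    rintro g h ⟨u, v, hg⟩ ⟨u', v', hh⟩
    refine ⟨u * u' - v * v', u * v' + v * u', ?_⟩
    rw [Units.val_mul, hg, hh]
    ext i j
    fin_cases i <;> fin_cases j <;> simp [Matrix.mul_apply, Fin.sum_univ_two] <;> ring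
  inv_mem' := by
    rintro g ⟨u, v, hg⟩
    refine ⟨(u * u + v * v)⁻¹ * u, (u * u + v * v)⁻¹ * (-v), ?_⟩
    rw [Matrix.coe_units_inv, Matrix.inv_def, hg, Matrix.adjugate_fin_two_of,
      Matrix.det_fin_two_of, Ring.inverse_eq_inv']
    ext i j
    fin_cases i <;> fin_cases j <;> simp

variable (E)

/-- Two frames are equivalent when they lie in the same `CO(2)`-orbit. -/
def orbitSetoid : Setoid (FrameBundle E) where
  r b c := ∃ g ∈ CO2, c = b.act g
  iseqv :=
    { refl := fun b => ⟨1, CO2.one_mem, b.act_one.symm⟩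
      symm := by
        rintro b c ⟨g, hg, rfl⟩
        exact ⟨g⁻¹, CO2.inv_mem hg, by rw [← FrameBundle.act_mul, mul_inv_cancel, b.act_one]⟩
      trans := by
        rintro b c d ⟨g, hg, rfl⟩ ⟨h, hh, rfl⟩
        exact ⟨g * h, CO2.mul_mem hg hh, (b.act_mul g h).symm⟩ }

/-- The quotient `B(E)/CO(2)`, with the quotient topology. -/
abbrev FrameQuotient : Type _ := Quotient (orbitSetoid E)

/-- The projection `B(E) → B(E)/CO(2)`. -/
def frameProj (b : FrameBundle E) : FrameQuotient E := Quotient.mk _ b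

end Frames

/-- The model with corners of the manifold `B(E)`, of dimension `(k + 1) + 4`. -/
abbrev modelB (k : ℕ) := (𝓡 (k + 1)).prod 𝓘(ℝ, F2 × F2)

/-- A `GL(2)`-structure: a smooth isomorphism of vector bundles `TM ≅ S^k(E)`. Smoothness means
that it turns symmetric products of smooth local sections of `E` into smooth vector fields; these
products span the local sections of `S^k(E)` over the smooth functions. -/
structure GL2Structure (k : ℕ) (M : Type*) [TopologicalSpace M]
    [ChartedSpace (EuclideanSpace ℝ (Fin (k + 1))) M] [IsManifold (𝓡 (k + 1)) ∞ M]
    (E : M → Type*) [∀ p, AddCommGroup (E p)] [∀ p, Module ℝ (E p)]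
    [∀ p, TopologicalSpace (E p)] [TopologicalSpace (TotalSpace F2 E)]
    [FiberBundle F2 E] [VectorBundle ℝ F2 E] where
  iso : ∀ p : M, TangentSpace (𝓡 (k + 1)) p ≃ₗ[ℝ] SymPow k (E p)
  smooth : ∀ (U : Set M), IsOpen U → ∀ s : Fin k → ∀ p : M, E p,
    (∀ i, ContMDiffOn (𝓡 (k + 1)) ((𝓡 (k + 1)).prod 𝓘(ℝ, F2)) ∞
      (fun p => TotalSpace.mk' F2 p (s i p)) U) →
    ContMDiffOn (𝓡 (k + 1)) (𝓡 (k + 1)).tangent ∞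
      (fun p => (⟨p, (iso p).symm (symProd fun i => s i p)⟩ : TangentBundle (𝓡 (k + 1)) M)) U

variable {k : ℕ} {M : Type*} [TopologicalSpace M]
  [ChartedSpace (EuclideanSpace ℝ (Fin (k + 1))) M] [IsManifold (𝓡 (k + 1)) ∞ M]
  {E : M → Type*} [∀ p, AddCommGroup (E p)] [∀ p, Module ℝ (E p)]
  [∀ p, TopologicalSpace (E p)] [TopologicalSpace (TotalSpace F2 E)]
  [FiberBundle F2 E] [VectorBundle ℝ F2 E]

/-- The soldering form `ω` on `B(E)` with values in `V[k]`: the projection of a tangent vector to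
`TM ≅ S^k(E)`, expressed in the frame `(x, y)`. Its coordinates in the monomials `x^{k-i} y^i` are
the forms `ω^i`. -/
def solderingForm (S : GL2Structure k M E) (b : FrameBundle E) :
    TangentSpace (modelB k) b →ₗ[ℝ] V k :=
  (polyEquiv k b.basis).toLinearMap ∘ₗ (S.iso b.1.proj).toLinearMap ∘ₗ
    (mfderiv (modelB k) (𝓡 (k + 1)) (fun c : FrameBundle E => c.1.proj) b).toLinearMap

/-- The horizontal complex-valued form `ξ^{k,j}` on `B(E)`. -/
def xi (S : GL2Structure k M E) (hk : Odd k) (j : Idx k) (b : FrameBundle E) :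
    TangentSpace (modelB k) b →ₗ[ℝ] ℂ :=
  xiV hk j ∘ₗ solderingForm S b

/-- The exponential map `gl(2) → GL(2)`. -/
def expGL (A : Matrix (Fin 2) (Fin 2) ℝ) : GL (Fin 2) ℝ := (Matrix.isUnit_exp A).unit

/-- The curve `t ↦ b · exp(tA)`; its velocity at `t = 0` is the value at `b` of the fundamental
vector field of `A`. -/
def fundamentalCurve (b : FrameBundle E) (A : Matrix (Fin 2) (Fin 2) ℝ) (t : ℝ) :
    FrameBundle E :=
  b.act (expGL (t • A))

variable (k) in
/-- `φ` is the form of a `GL(2)`-connection on `B(E)`: a smooth `gl(2)`-valued 1-form that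
reproduces the generators of the fundamental vector fields and satisfies `R_g^* φ = g⁻¹ φ g`. As a
matrix, `φ = (φ^1_1, φ^2_1; φ^1_2, φ^2_2)`: the lower index is the row, the upper one the column. -/
structure IsGL2Connection [ContMDiffVectorBundle ∞ F2 E (𝓡 (k + 1))]
    (φ : ∀ b : FrameBundle E, TangentSpace (modelB k) b →ₗ[ℝ] Matrix (Fin 2) (Fin 2) ℝ) :
    Prop where
  smooth : ∀ i j : Fin 2, ContMDiff (modelB k).tangent 𝓘(ℝ, ℝ) ∞
    (fun v : TangentBundle (modelB k) (FrameBundle E) => φ v.proj v.snd i j)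
  fundamental : ∀ (b : FrameBundle E) (A : Matrix (Fin 2) (Fin 2) ℝ),
    φ (fundamentalCurve b A 0)
      (mfderiv 𝓘(ℝ, ℝ) (modelB k) (fundamentalCurve b A) 0 (1 : ℝ)) = A
  equivariant : ∀ (g : GL (Fin 2) ℝ) (b : FrameBundle E) (v : TangentSpace (modelB k) b),
    φ (b.act g) (mfderiv (modelB k) (modelB k) (fun c : FrameBundle E => c.act g) b v)
      = (g⁻¹ : GL (Fin 2) ℝ).val * φ b v * g.val

/-- `ζ = (φ^1_2 + φ^2_1) + i (φ^2_2 - φ^1_1)`. -/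
def zeta (φ : ∀ b : FrameBundle E, TangentSpace (modelB k) b →ₗ[ℝ] Matrix (Fin 2) (Fin 2) ℝ)
    (b : FrameBundle E) : TangentSpace (modelB k) b →ₗ[ℝ] ℂ where
  toFun v := ((φ b v 1 0 + φ b v 0 1 : ℝ) : ℂ) + Complex.I * ((φ b v 1 1 - φ b v 0 0 : ℝ) : ℂ)
  map_add' v w := by simp; ring
  map_smul' c v := by simp; ring

end Geometry

section AlmostComplex

variable {d : ℕ} {N : Type*} [TopologicalSpace N] [ChartedSpace (EuclideanSpace ℝ (Fin d)) N]

/-- A (smooth) almost-complex structure on a manifold. -/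
structure IsAlmostComplex [IsManifold (𝓡 d) ∞ N]
    (J : ∀ z : N, TangentSpace (𝓡 d) z →ₗ[ℝ] TangentSpace (𝓡 d) z) : Prop where
  sq : ∀ (z : N) (v : TangentSpace (𝓡 d) z), J z (J z v) = -v
  smooth : ContMDiff (𝓡 d).tangent (𝓡 d).tangent ∞
    (fun v : TangentBundle (𝓡 d) N => (⟨v.proj, J v.proj v.snd⟩ : TangentBundle (𝓡 d) N))

/-- `α` is a `(1,0)`-form at `z`: `α ∘ J = i α`. -/
def IsOneZero (J : ∀ z : N, TangentSpace (𝓡 d) z →ₗ[ℝ] TangentSpace (𝓡 d) z) (z : N)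
    (α : TangentSpace (𝓡 d) z →ₗ[ℝ] ℂ) : Prop :=
  ∀ v, α (J z v) = Complex.I * α v

end AlmostComplex

/-- A smooth submersion. -/
structure IsSmoothSubmersion {V₁ H₁ V₂ H₂ : Type*} [NormedAddCommGroup V₁] [NormedSpace ℝ V₁]
    [TopologicalSpace H₁] [NormedAddCommGroup V₂] [NormedSpace ℝ V₂] [TopologicalSpace H₂]
    (I₁ : ModelWithCorners ℝ V₁ H₁) (I₂ : ModelWithCorners ℝ V₂ H₂) {N₁ N₂ : Type*}
    [TopologicalSpace N₁] [ChartedSpace H₁ N₁] [TopologicalSpace N₂] [ChartedSpace H₂ N₂]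
    (f : N₁ → N₂) : Prop where
  contMDiff : ContMDiff I₁ I₂ ∞ f
  surjective_mfderiv : ∀ x : N₁, Function.Surjective (mfderiv I₁ I₂ f x)

end GL2Geometry
end

open scoped Manifold ContDiff Bundle
open GL2Geometry

noncomputable section
set_option linter.unusedSectionVars false
set_option linter.unnecessarySeqFocus false
set_option linter.style.haveILetI false
namespace GL2Geometry
open scoped Manifold ContDiff Bundle Topology
open Bundle


/-! Over a trivialization of `E` a frame is a pair (x, y) of vectors of ℝ², that is, two complex
numbers z_i = x_i + i y_i. The matrix (u, -v; v, u) multiplies both z_i by u - iv, so the orbit is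
determined by τ = z_0 / z_1, and (x, y) is independent exactly when Im τ ≠ 0. The base point and τ
are therefore coordinates on B(E)/CO(2), with fibre ℂ \ ℝ. Prescribing z_1 gives smooth local
sections, from which follow the smoothness of the transition maps and the fact that q is a
submersion.

The forms ξ^{k,j} and ζ are packed into one form F with values in a complex space of real dimension
k + 3, and multiplication by i descends for two reasons. First, ker F = ker dq: a vector killed by F
is vertical with φ-value in co(2), hence tangent to the orbit, and a dimension count gives equality
(`ker_iff_and_surjective_of_vertical`). So F identifies the tangent space at q(b) with a complex
vector space. Second, translation by an element of CO(2) multiplies each component of F by a complex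
constant (`xi_act`, `zeta_act`), so all the frames of an orbit induce the same complex structure
although F itself does not descend.

For smoothness, along a local section σ of q the vector J w solves F(dσ(J w)) = i F(dσ w), an
invertible linear system with smooth coefficients (`contMDiff_pushforward`). The smoothness of ξ
requires inverting the isomorphism TM ≅ S^k(E), whose smoothness is given on symmetric products of
sections; this is again a linear system (`exists_contMDiffAt_polyCoords`). Uniqueness holds because
complex functionals separate the values of F. -/

/-! ### Pairs of plane vectors and their complex slope -/

section Slope

/-- The complex number `x_i + i y_i` attached to a pair of vectors `(x, y)` of `ℝ²`. -/
def complexCoord (w : F2 × F2) (i : Fin 2) : ℂ := ⟨w.1 i, w.2 i⟩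

/-- The ratio of the complex coordinates of a pair of vectors of `ℝ²`; it is a complete invariant
of the `CO(2)`-orbit of a frame. -/
def slope (w : F2 × F2) : ℂ := complexCoord w 0 / complexCoord w 1

/-- The pair of vectors with complex coordinates `(c τ, c)`. -/
def pairOfSlope (c τ : ℂ) : F2 × F2 := (!₂[(c * τ).re, c.re], !₂[(c * τ).im, c.im])

theorem complexCoord_pairOfSlope_zero (c τ : ℂ) : complexCoord (pairOfSlope c τ) 0 = c * τ := rfl

theorem complexCoord_pairOfSlope_one (c τ : ℂ) : complexCoord (pairOfSlope c τ) 1 = c := rfl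

theorem complexCoord_injective {w w' : F2 × F2} (h : complexCoord w = complexCoord w') :
    w = w' := by
  have h0 := fun i => congrArg Complex.re (congrFun h i)
  have h1 := fun i => congrArg Complex.im (congrFun h i)
  exact Prod.ext (PiLp.ext h0) (PiLp.ext h1)

theorem slope_pairOfSlope {c : ℂ} (hc : c ≠ 0) (τ : ℂ) : slope (pairOfSlope c τ) = τ := by
  rw [slope, complexCoord_pairOfSlope_zero, complexCoord_pairOfSlope_one, mul_div_cancel_left₀ _ hc]

theorem slope_im (w : F2 × F2) : (slope w).im
    = (w.2 0 * w.1 1 - w.1 0 * w.2 1) / Complex.normSq (complexCoord w 1) := by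
  rw [slope, Complex.div_im]
  simp only [complexCoord]
  ring

/-- Up to sign, Im τ is the determinant of the pair divided by |z_1|². If z_1 = 0, division by zero
gives τ = 0, in agreement with the pair being dependent. -/
theorem linearIndependent_pair_iff_slope (w : F2 × F2) :
    LinearIndependent ℝ ![w.1, w.2] ↔ (slope w).im ≠ 0 := by
  rw [LinearIndependent.pair_iff]
  constructor
  · intro h him
    have hdet : w.2 0 * w.1 1 - w.1 0 * w.2 1 = 0 := by
      rw [slope_im, div_eq_zero_iff] at him
      rcases him with h0 | h0
      · exact h0
      · have h1 := Complex.normSq_eq_zero.1 h0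
        have hr : w.1 1 = 0 := congrArg Complex.re h1
        have hi : w.2 1 = 0 := congrArg Complex.im h1
        rw [hr, hi]; ring
    -- With vanishing determinant y_i x - x_i y = 0 for i = 0, 1; independence then forces x_0 = x_1
    -- = 0, so x = 0.
    have e0 := h (w.2 0) (-w.1 0) (by
      ext i; fin_cases i
      · simp; ring
      · simp; linear_combination hdet)
    have e1 := h (w.2 1) (-w.1 1) (by
      ext i; fin_cases i
      · simp; linear_combination -hdet
      · simp; ring)
    have := h 1 0 (by
      ext i; fin_cases i
      · simpa using e0.2
      · simpa using e1.2)
    exact one_ne_zero this.1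
  · intro him s t hst
    have hdet : w.2 0 * w.1 1 - w.1 0 * w.2 1 ≠ 0 := by
      intro h0; apply him; rw [slope_im, h0, zero_div]
    have h0 : s * w.1 0 + t * w.2 0 = 0 := by simpa using congrFun (congrArg WithLp.ofLp hst) 0
    have h1 : s * w.1 1 + t * w.2 1 = 0 := by simpa using congrFun (congrArg WithLp.ofLp hst) 1
    constructor
    · apply (mul_eq_zero.1 (?_ : (w.2 0 * w.1 1 - w.1 0 * w.2 1) * s = 0)).resolve_left hdet
      linear_combination w.2 0 * h1 - w.2 1 * h0
    · apply (mul_eq_zero.1 (?_ : (w.2 0 * w.1 1 - w.1 0 * w.2 1) * t = 0)).resolve_left hdet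
      linear_combination w.1 1 * h0 - w.1 0 * h1

theorem complexCoord_one_ne_zero {w : F2 × F2} (h : (slope w).im ≠ 0) : complexCoord w 1 ≠ 0 := by
  intro h0
  apply h
  rw [slope, h0, div_zero, Complex.zero_im]

theorem pairOfSlope_slope {w : F2 × F2} (h : (slope w).im ≠ 0) :
    pairOfSlope (complexCoord w 1) (slope w) = w := by
  have h1 := complexCoord_one_ne_zero h
  apply complexCoord_injective
  funext i
  fin_cases i
  · change complexCoord _ 1 * slope w = _
    rw [slope, mul_div_cancel₀ _ h1]; rfl
  · rfl

end Slope

/-! ### The slope of a frame and the CO(2)-orbits -/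

section Chart

variable {k : ℕ} {M : Type*} [TopologicalSpace M]
  [ChartedSpace (EuclideanSpace ℝ (Fin (k + 1))) M]
  (E : M → Type*) [∀ p, AddCommGroup (E p)]
  [∀ p, Module ℝ (E p)] [∀ p, TopologicalSpace (E p)] [TopologicalSpace (TotalSpace F2 E)]
  [FiberBundle F2 E] [VectorBundle ℝ F2 E]

/-- The trivialization of `E ⊕ E` induced by the preferred trivialization of `E` at `p`. -/
abbrev frameTriv (p : M) : Trivialization (F2 × F2) (π (F2 × F2) (E ×ᵇ E)) :=
  (trivializationAt F2 E p).prod (trivializationAt F2 E p)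

variable {E}

theorem mem_frameTriv_source {p : M} {b : TotalSpace (F2 × F2) (E ×ᵇ E)} :
    b ∈ (frameTriv E p).source ↔ b.proj ∈ (trivializationAt F2 E p).baseSet := by
  rw [Trivialization.mem_source, Trivialization.prod_baseSet, Set.inter_self]

theorem mem_frameTriv_target {p : M} {w : M × (F2 × F2)} :
    w ∈ (frameTriv E p).target ↔ w.1 ∈ (trivializationAt F2 E p).baseSet := by
  rw [Trivialization.mem_target, Trivialization.prod_baseSet, Set.inter_self]

theorem mem_frameOpens_iff_slope {p : M} {b : TotalSpace (F2 × F2) (E ×ᵇ E)}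
    (hb : b.proj ∈ (trivializationAt F2 E p).baseSet) :
    b ∈ frameOpens E ↔ (slope (frameTriv E p b).2).im ≠ 0 := by
  rw [← linearIndependent_pair_iff_slope]
  have h1 : ![(frameTriv E p b).2.1, (frameTriv E p b).2.2]
      = ((trivializationAt F2 E p).linearEquivAt ℝ b.proj hb : E b.proj → F2)
        ∘ ![b.2.1, b.2.2] := by
    funext i; fin_cases i <;> rfl
  rw [h1]
  exact (LinearMap.linearIndependent_iff
    ((trivializationAt F2 E p).linearEquivAt ℝ b.proj hb).toLinearMap
    ((trivializationAt F2 E p).linearEquivAt ℝ b.proj hb).ker).symm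

theorem frameTriv_act {p : M} {b : FrameBundle E}
    (hb : b.1.proj ∈ (trivializationAt F2 E p).baseSet) (g : GL (Fin 2) ℝ) :
    (frameTriv E p (b.act g).1).2
      = (g 0 0 • (frameTriv E p b.1).2.1 + g 1 0 • (frameTriv E p b.1).2.2,
          g 0 1 • (frameTriv E p b.1).2.1 + g 1 1 • (frameTriv E p b.1).2.2) := by
  let L := (trivializationAt F2 E p).linearEquivAt ℝ b.1.proj hb
  change (L (g 0 0 • b.fst + g 1 0 • b.snd), L (g 0 1 • b.fst + g 1 1 • b.snd))
    = (g 0 0 • L b.fst + g 1 0 • L b.snd, g 0 1 • L b.fst + g 1 1 • L b.snd)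
  simp

/-- Both complex coordinates are multiplied by u - iv, which is nonzero and cancels in the ratio. -/
theorem slope_act {p : M} {b : FrameBundle E}
    (hb : b.1.proj ∈ (trivializationAt F2 E p).baseSet) {g : GL (Fin 2) ℝ} (hg : g ∈ CO2) :
    slope (frameTriv E p (b.act g).1).2 = slope (frameTriv E p b.1).2 := by
  obtain ⟨u, v, huv⟩ := hg
  have hdet := g.det.ne_zero
  rw [Matrix.GeneralLinearGroup.val_det_apply, huv, Matrix.det_fin_two_of] at hdet
  have hc : ∀ i, complexCoord (frameTriv E p (b.act g).1).2 i
      = ⟨u, -v⟩ * complexCoord (frameTriv E p b.1).2 i := by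
    intro i
    rw [frameTriv_act hb, huv]
    apply Complex.ext <;> simp [complexCoord] <;> ring
  rw [slope, hc, hc, mul_div_mul_left, slope]
  intro h0
  apply hdet
  have h1 : u = 0 := congrArg Complex.re h0
  have h2 : -v = 0 := congrArg Complex.im h0
  rw [h1, h2]; ring

/-- Two frames at the same point with the same slope lie in one orbit. -/
theorem exists_act_of_slope_eq {p : M} {b b' : FrameBundle E} (hp : b.1.proj = b'.1.proj)
    (hb : b.1.proj ∈ (trivializationAt F2 E p).baseSet)
    (h : slope (frameTriv E p b.1).2 = slope (frameTriv E p b'.1).2) :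
    ∃ g ∈ CO2, b' = b.act g := by
  have hb' : b'.1.proj ∈ (trivializationAt F2 E p).baseSet := hp ▸ hb
  have n1 := complexCoord_one_ne_zero ((mem_frameOpens_iff_slope hb).1 b.2)
  have n2 := complexCoord_one_ne_zero ((mem_frameOpens_iff_slope hb').1 b'.2)
  set w := (frameTriv E p b.1).2 with hw
  set w' := (frameTriv E p b'.1).2 with hw'
  -- Equal slopes make both complex coordinates differ by this same factor c; the group element with
  -- u - iv = c has u = Re c and v = -Im c.
  set c := complexCoord w' 1 / complexCoord w 1 with hc
  have hc0 : c ≠ 0 := div_ne_zero n2 n1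
  have hcoord : ∀ i, complexCoord w' i = c * complexCoord w i := by
    intro i
    fin_cases i
    · change complexCoord w' 0 = c * complexCoord w 0
      rw [slope, slope, div_eq_div_iff n1 n2] at h
      rw [hc]; field_simp; linear_combination -h
    · change complexCoord w' 1 = c * complexCoord w 1
      rw [hc]; field_simp
  have hdet : (!![c.re, c.im; -c.im, c.re] : Matrix (Fin 2) (Fin 2) ℝ).det ≠ 0 := by
    rw [Matrix.det_fin_two_of]
    intro h0
    apply hc0
    rw [← Complex.normSq_eq_zero, Complex.normSq_apply]
    linear_combination h0
  refine ⟨Matrix.GeneralLinearGroup.mkOfDetNeZero _ hdet, ⟨c.re, -c.im, ?_⟩, ?_⟩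
  · simp [Matrix.GeneralLinearGroup.mkOfDetNeZero]
  · apply Subtype.ext
    refine (frameTriv E p).injOn (mem_frameTriv_source.2 hb')
      ((mem_frameTriv_source (b := (b.act _).1)).2 hb) ?_
    simp only [Trivialization.coe_coe]
    refine Prod.ext ?_ ?_
    · rw [Trivialization.coe_fst _ (mem_frameTriv_source.2 hb'),
        Trivialization.coe_fst _ ((mem_frameTriv_source (b := (b.act _).1)).2 hb)]
      exact hp.symm
    · rw [frameTriv_act hb]
      apply complexCoord_injective
      funext i
      rw [← hw', hcoord i, ← hw]
      apply Complex.ext <;>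
        simp [complexCoord, Matrix.GeneralLinearGroup.mkOfDetNeZero] <;> ring

end Chart

/-! ### Slope coordinates on the frame bundle and their local sections -/

section Chart

variable {k : ℕ} {M : Type*} [TopologicalSpace M]
  [ChartedSpace (EuclideanSpace ℝ (Fin (k + 1))) M]
  (E : M → Type*) [∀ p, AddCommGroup (E p)]
  [∀ p, Module ℝ (E p)] [∀ p, TopologicalSpace (E p)] [TopologicalSpace (TotalSpace F2 E)]
  [FiberBundle F2 E] [VectorBundle ℝ F2 E]

/-- A linear identification of `ℝ^(k+3)` with `ℝ^(k+1) × ℂ`. -/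
def coordsEquiv (k : ℕ) :
    EuclideanSpace ℝ (Fin (k + 3)) ≃L[ℝ] EuclideanSpace ℝ (Fin (k + 1)) × ℂ :=
  ContinuousLinearEquiv.ofFinrankEq (by simp [Module.finrank_prod, Complex.finrank_real_complex])

/-- The frames lying over the chart and trivialization domains at `p`. -/
def slopeDomain (k : ℕ) [ChartedSpace (EuclideanSpace ℝ (Fin (k + 1))) M] (p : M) :
    Set (FrameBundle E) :=
  {b | b.1.proj ∈ (chartAt (EuclideanSpace ℝ (Fin (k + 1))) p).source ∩
    (trivializationAt F2 E p).baseSet}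

/-- The coordinates of the base point of a frame together with its slope. -/
def slopeCoord (k : ℕ) [ChartedSpace (EuclideanSpace ℝ (Fin (k + 1))) M] (p : M)
    (b : FrameBundle E) : EuclideanSpace ℝ (Fin (k + 3)) :=
  (coordsEquiv k).symm (chartAt _ p b.1.proj, slope (frameTriv E p b.1).2)

/-- The image of `slopeCoord`. -/
def slopeTarget (k : ℕ) [ChartedSpace (EuclideanSpace ℝ (Fin (k + 1))) M] (p : M) :
    Set (EuclideanSpace ℝ (Fin (k + 3))) :=
  {t | ((coordsEquiv k t).1 ∈ (chartAt (EuclideanSpace ℝ (Fin (k + 1))) p).target ∩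
      (chartAt (EuclideanSpace ℝ (Fin (k + 1))) p).symm ⁻¹' (trivializationAt F2 E p).baseSet) ∧
    (coordsEquiv k t).2.im ≠ 0}

/-- The element of `E ⊕ E` with given coordinates and second complex coordinate `c`. -/
def slopePoint (k : ℕ) [ChartedSpace (EuclideanSpace ℝ (Fin (k + 1))) M] (p : M) (c : ℂ)
    (t : EuclideanSpace ℝ (Fin (k + 3))) : TotalSpace (F2 × F2) (E ×ᵇ E) :=
  (frameTriv E p).toOpenPartialHomeomorph.symm
    ((chartAt (EuclideanSpace ℝ (Fin (k + 1))) p).symm (coordsEquiv k t).1,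
      pairOfSlope c (coordsEquiv k t).2)

open Classical in
/-- The local section of `slopeCoord` consisting of the frames with second complex coordinate `c`
(with value `b₀` outside of its natural domain). -/
def slopeSection (k : ℕ) [ChartedSpace (EuclideanSpace ℝ (Fin (k + 1))) M] (p : M) (c : ℂ)
    (b₀ : FrameBundle E) (t : EuclideanSpace ℝ (Fin (k + 3))) : FrameBundle E :=
  if h : slopePoint E k p c t ∈ frameOpens E then ⟨slopePoint E k p c t, h⟩ else b₀

variable {E} {p : M}

theorem slopeCoord_mem_slopeTarget {b : FrameBundle E} (hb : b ∈ slopeDomain E k p) :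
    slopeCoord E k p b ∈ slopeTarget E k p := by
  refine ⟨?_, ?_⟩
  · simp only [slopeCoord, ContinuousLinearEquiv.apply_symm_apply]
    refine ⟨(chartAt _ p).map_source hb.1, ?_⟩
    rw [Set.mem_preimage, (chartAt _ p).left_inv hb.1]
    exact hb.2
  · simp only [slopeCoord, ContinuousLinearEquiv.apply_symm_apply]
    exact (mem_frameOpens_iff_slope hb.2).1 b.2

theorem slopePoint_proj {t : EuclideanSpace ℝ (Fin (k + 3))} (ht : t ∈ slopeTarget E k p)
    (c : ℂ) : (slopePoint E k p c t).proj
      = (chartAt (EuclideanSpace ℝ (Fin (k + 1))) p).symm (coordsEquiv k t).1 :=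
  Trivialization.proj_symm_apply _ (mem_frameTriv_target.2 ht.1.2)

theorem frameTriv_slopePoint {t : EuclideanSpace ℝ (Fin (k + 3))} (ht : t ∈ slopeTarget E k p)
    (c : ℂ) : frameTriv E p (slopePoint E k p c t)
      = ((chartAt (EuclideanSpace ℝ (Fin (k + 1))) p).symm (coordsEquiv k t).1,
        pairOfSlope c (coordsEquiv k t).2) :=
  Trivialization.apply_symm_apply _ (mem_frameTriv_target.2 ht.1.2)

theorem slopePoint_mem {t : EuclideanSpace ℝ (Fin (k + 3))} (ht : t ∈ slopeTarget E k p)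
    {c : ℂ} (hc : c ≠ 0) : slopePoint E k p c t ∈ frameOpens E := by
  rw [mem_frameOpens_iff_slope (p := p) (by rw [slopePoint_proj ht]; exact ht.1.2),
    frameTriv_slopePoint ht, slope_pairOfSlope hc]
  exact ht.2

theorem slopeSection_val {t : EuclideanSpace ℝ (Fin (k + 3))} (ht : t ∈ slopeTarget E k p)
    {c : ℂ} (hc : c ≠ 0) (b₀ : FrameBundle E) :
    (slopeSection E k p c b₀ t).1 = slopePoint E k p c t := by
  rw [slopeSection, dif_pos (slopePoint_mem ht hc)]

theorem slopeSection_mem_slopeDomain {t : EuclideanSpace ℝ (Fin (k + 3))}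
    (ht : t ∈ slopeTarget E k p) {c : ℂ} (hc : c ≠ 0) (b₀ : FrameBundle E) :
    slopeSection E k p c b₀ t ∈ slopeDomain E k p := by
  rw [slopeDomain, Set.mem_ofPred_eq, slopeSection_val ht hc, slopePoint_proj ht]
  exact ⟨(chartAt _ p).map_target ht.1.1, ht.1.2⟩

theorem slopeCoord_slopeSection {t : EuclideanSpace ℝ (Fin (k + 3))}
    (ht : t ∈ slopeTarget E k p) {c : ℂ} (hc : c ≠ 0) (b₀ : FrameBundle E) :
    slopeCoord E k p (slopeSection E k p c b₀ t) = t := by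
  rw [slopeCoord, slopeSection_val ht hc, slopePoint_proj ht, frameTriv_slopePoint ht,
    slope_pairOfSlope hc, (chartAt _ p).right_inv ht.1.1]
  exact (coordsEquiv k).symm_apply_apply t

/-- The parameter c of the sections exists for this: with c the second complex coordinate of b, the
section passes through b itself and not merely through its orbit. -/
theorem slopeSection_slopeCoord {b : FrameBundle E} (hb : b ∈ slopeDomain E k p)
    (b₀ : FrameBundle E) :
    slopeSection E k p (complexCoord (frameTriv E p b.1).2 1) b₀ (slopeCoord E k p b) = b := by
  have him := (mem_frameOpens_iff_slope hb.2).1 b.2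
  apply Subtype.ext
  rw [slopeSection_val (slopeCoord_mem_slopeTarget hb) (complexCoord_one_ne_zero him),
    slopePoint, slopeCoord, ContinuousLinearEquiv.apply_symm_apply]
  simp only
  rw [(chartAt _ p).left_inv hb.1, pairOfSlope_slope him]
  exact Trivialization.symm_apply_mk_proj _ (mem_frameTriv_source.2 hb.2)

theorem slopeCoord_eq_iff {b b' : FrameBundle E} (hb : b ∈ slopeDomain E k p)
    (hb' : b' ∈ slopeDomain E k p) :
    slopeCoord E k p b = slopeCoord E k p b' ↔ frameProj E b = frameProj E b' := by
  rw [frameProj, frameProj, Quotient.eq, slopeCoord, slopeCoord,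
    (coordsEquiv k).symm.injective.eq_iff, Prod.mk.injEq]
  constructor
  · rintro ⟨h1, h2⟩
    exact exists_act_of_slope_eq ((chartAt _ p).injOn hb.1 hb'.1 h1) hb.2 h2
  · rintro ⟨g, hg, rfl⟩
    exact ⟨rfl, (slope_act hb.2 hg).symm⟩

theorem isOpen_slopeDomain : IsOpen (slopeDomain E k p) :=
  ((chartAt _ p).open_source.inter (trivializationAt F2 E p).open_baseSet).preimage
    ((FiberBundle.continuous_proj (F2 × F2) (E ×ᵇ E)).comp continuous_subtype_val)

theorem isOpen_slopeTarget : IsOpen (slopeTarget E k p) := by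
  refine IsOpen.inter (IsOpen.preimage (by fun_prop : Continuous fun t => (coordsEquiv k t).1)
    ((chartAt _ p).isOpen_inter_preimage_symm (trivializationAt F2 E p).open_baseSet)) ?_
  exact isOpen_ne_fun (Complex.continuous_im.comp (by fun_prop)) continuous_const

end Chart

/-! ### Smoothness of slope coordinates and sections -/

section Smooth

variable {k : ℕ} {M : Type*} [TopologicalSpace M]
  [ChartedSpace (EuclideanSpace ℝ (Fin (k + 1))) M]
  {E : M → Type*} [∀ p, AddCommGroup (E p)]
  [∀ p, Module ℝ (E p)] [∀ p, TopologicalSpace (E p)] [TopologicalSpace (TotalSpace F2 E)]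
  [FiberBundle F2 E] [VectorBundle ℝ F2 E]
  [IsManifold (𝓡 (k + 1)) ∞ M] [ContMDiffVectorBundle ∞ F2 E (𝓡 (k + 1))] {p : M}

theorem contDiff_complexCoord (i : Fin 2) : ContDiff ℝ ∞ fun w : F2 × F2 => complexCoord w i := by
  have : (fun w : F2 × F2 => complexCoord w i)
      = fun w => (w.1 i : ℂ) + (w.2 i : ℂ) * Complex.I := by
    funext w; apply Complex.ext <;> simp [complexCoord]
  rw [this]
  have h1 : ContDiff ℝ ∞ fun w : F2 × F2 => (w.1 i : ℂ) :=
    Complex.ofRealCLM.contDiff.comp (by fun_prop)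
  have h2 : ContDiff ℝ ∞ fun w : F2 × F2 => (w.2 i : ℂ) :=
    Complex.ofRealCLM.contDiff.comp (by fun_prop)
  exact h1.add (h2.mul contDiff_const)

theorem contDiffAt_slope {w : F2 × F2} (h : (slope w).im ≠ 0) : ContDiffAt ℝ ∞ slope w := by
  rw [show slope = fun w => complexCoord w 0 * (complexCoord w 1)⁻¹ from
    funext fun w => div_eq_mul_inv _ _]
  exact (contDiff_complexCoord 0).contDiffAt.mul
    ((contDiffAt_inv ℝ (complexCoord_one_ne_zero h)).comp w (contDiff_complexCoord 1).contDiffAt)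

theorem contDiff_pairOfSlope (c : ℂ) : ContDiff ℝ ∞ (pairOfSlope c) := by
  have h1 : ContDiff ℝ ∞ fun τ : ℂ => (c * τ).re :=
    Complex.reCLM.contDiff.comp (contDiff_const.mul contDiff_id)
  have h2 : ContDiff ℝ ∞ fun τ : ℂ => (c * τ).im :=
    Complex.imCLM.contDiff.comp (contDiff_const.mul contDiff_id)
  refine ContDiff.prodMk ?_ ?_ <;> rw [contDiff_euclidean] <;> intro i <;> fin_cases i
  · exact h1
  · exact contDiff_const
  · exact h2
  · exact contDiff_const

theorem contMDiff_frameBundle_proj :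
    ContMDiff (modelB k) (𝓡 (k + 1)) ∞ (fun b : FrameBundle E => b.1.proj) :=
  (contMDiff_proj (E ×ᵇ E)).comp contMDiff_subtype_val

theorem contMDiffAt_frameTriv_snd {b : FrameBundle E}
    (hb : b.1.proj ∈ (trivializationAt F2 E p).baseSet) :
    ContMDiffAt (modelB k) 𝓘(ℝ, F2 × F2) ∞
      (fun b : FrameBundle E => (frameTriv E p b.1).2) b := by
  have h1 := (Trivialization.contMDiffOn (n := ∞) (IB := 𝓡 (k + 1)) (frameTriv E p)).contMDiffAt
    ((frameTriv E p).open_source.mem_nhds (mem_frameTriv_source.2 hb))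
  have h2 := h1.comp b contMDiff_subtype_val.contMDiffAt
  exact contMDiffAt_snd.comp b h2

theorem contMDiffAt_slopeCoord {b : FrameBundle E} (hb : b ∈ slopeDomain E k p) :
    ContMDiffAt (modelB k) (𝓡 (k + 3)) ∞ (slopeCoord E k p) b := by
  have h1 : ContMDiffAt (modelB k) (𝓡 (k + 1)) ∞
      (fun b : FrameBundle E => chartAt (EuclideanSpace ℝ (Fin (k + 1))) p b.1.proj) b :=
    (contMDiffAt_of_mem_maximalAtlas (IsManifold.chart_mem_maximalAtlas p) hb.1).comp b
      contMDiff_frameBundle_proj.contMDiffAt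
  have h2 : ContMDiffAt (modelB k) 𝓘(ℝ, ℂ) ∞
      (fun b : FrameBundle E => slope (frameTriv E p b.1).2) b :=
    (contDiffAt_slope ((mem_frameOpens_iff_slope hb.2).1 b.2)).contMDiffAt.comp b
      (contMDiffAt_frameTriv_snd hb.2)
  exact (coordsEquiv k).symm.contDiff.contMDiff.contMDiffAt.comp b (h1.prodMk_space h2)

theorem contMDiffAt_slopeSection {t : EuclideanSpace ℝ (Fin (k + 3))}
    (ht : t ∈ slopeTarget E k p) {c : ℂ} (hc : c ≠ 0) (b₀ : FrameBundle E) :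
    ContMDiffAt (𝓡 (k + 3)) (modelB k) ∞ (slopeSection E k p c b₀) t := by
  rw [← ContMDiffAt.subtypeVal_comp_iff]
  have h1 : ContMDiffAt (𝓡 (k + 3)) (𝓡 (k + 1)) ∞ (fun t : EuclideanSpace ℝ (Fin (k + 3)) =>
      (chartAt (EuclideanSpace ℝ (Fin (k + 1))) p).symm (coordsEquiv k t).1) t :=
    (contMDiffAt_symm_of_mem_maximalAtlas (IsManifold.chart_mem_maximalAtlas p) ht.1.1).comp t
      (contDiff_fst.comp (coordsEquiv k).contDiff).contMDiff.contMDiffAt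
  have h2 : ContMDiffAt (𝓡 (k + 3)) 𝓘(ℝ, F2 × F2) ∞ (fun t : EuclideanSpace ℝ (Fin (k + 3)) =>
      pairOfSlope c (coordsEquiv k t).2) t :=
    ((contDiff_pairOfSlope c).comp
      (contDiff_snd.comp (coordsEquiv k).contDiff)).contMDiff.contMDiffAt
  have h3 := ((Trivialization.contMDiffOn_symm (n := ∞) (IB := 𝓡 (k + 1))
    (frameTriv E p)).contMDiffAt ((frameTriv E p).open_target.mem_nhds
      (mem_frameTriv_target.2 ht.1.2 : (_, pairOfSlope c (coordsEquiv k t).2) ∈ _))).comp t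
        (h1.prodMk h2)
  refine h3.congr_of_eventuallyEq ?_
  filter_upwards [isOpen_slopeTarget.mem_nhds ht] with s hs
  exact slopeSection_val hs hc b₀

end Smooth

/-! ### A criterion for submersions in charts of the target -/

section SubmersionCriterion

variable {V₁ H₁ V₂ H₂ : Type*} [NormedAddCommGroup V₁] [NormedSpace ℝ V₁]
  [TopologicalSpace H₁] [NormedAddCommGroup V₂] [NormedSpace ℝ V₂] [TopologicalSpace H₂]
  {I₁ : ModelWithCorners ℝ V₁ H₁} {I₂ : ModelWithCorners ℝ V₂ H₂} {N₁ N₂ : Type*}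
  [TopologicalSpace N₁] [ChartedSpace H₁ N₁] [TopologicalSpace N₂] [ChartedSpace H₂ N₂]
  [IsManifold I₂ ∞ N₂] {f : N₁ → N₂}

theorem surjective_mfderiv_symm_of_mem_maximalAtlas {e : OpenPartialHomeomorph N₂ H₂}
    (he : e ∈ IsManifold.maximalAtlas I₂ ∞ N₂) {t : H₂} (ht : t ∈ e.target) :
    Function.Surjective (mfderiv I₂ I₂ e.symm t) := by
  have hd : e.MDifferentiable I₂ I₂ :=
    ⟨(contMDiffOn_of_mem_maximalAtlas he).mdifferentiableOn (by simp),
      (contMDiffOn_symm_of_mem_maximalAtlas he).mdifferentiableOn (by simp)⟩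
  exact hd.symm.mfderiv_surjective ht

/-- A map that is given in charts of its target by smooth maps with smooth local sections is a
submersion. -/
theorem isSmoothSubmersion_of_charts
    (h : ∀ x : N₁, ∃ e ∈ IsManifold.maximalAtlas I₂ ∞ N₂, ∃ (g : N₁ → H₂) (σ : H₂ → N₁),
      ContMDiffAt I₁ I₂ ∞ g x ∧ g x ∈ e.target ∧ ContMDiffAt I₂ I₁ ∞ σ (g x) ∧ σ (g x) = x ∧
      (∀ᶠ y in 𝓝 x, f y = e.symm (g y)) ∧ ∀ᶠ t in 𝓝 (g x), f (σ t) = e.symm t) :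
    IsSmoothSubmersion I₁ I₂ f := by
  have hf : ContMDiff I₁ I₂ ∞ f := fun x => by
    obtain ⟨e, he, g, σ, hg, ht, -, -, hfg, -⟩ := h x
    exact ((contMDiffAt_symm_of_mem_maximalAtlas he ht).comp x hg).congr_of_eventuallyEq hfg
  refine ⟨hf, fun x => ?_⟩
  obtain ⟨e, he, g, σ, -, ht, hσ, hσx, -, hfσ⟩ := h x
  -- Near g x the composite f ∘ σ is an inverse chart, whose differential is onto; by the chain rule
  -- the differential of f at σ (g x) = x is onto.
  have h1 := mfderiv_comp (g x) ((hf (σ (g x))).mdifferentiableAt (by simp))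
    (hσ.mdifferentiableAt (by simp))
  have h2 := surjective_mfderiv_symm_of_mem_maximalAtlas he ht
  rw [← Filter.EventuallyEq.mfderiv_eq hfσ] at h2
  have h3 : Function.Surjective (mfderiv I₁ I₂ f (σ (g x))) := by
    change Function.Surjective (mfderiv I₂ I₂ (f ∘ σ) (g x)) at h2
    rw [h1] at h2
    exact Function.Surjective.of_comp h2
  rwa [hσx] at h3

end SubmersionCriterion

/-! ### The manifold B(E)/CO(2) -/

section QuotientManifold

variable {k : ℕ} {M : Type*} [TopologicalSpace M]
  [ChartedSpace (EuclideanSpace ℝ (Fin (k + 1))) M]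
  {E : M → Type*} [∀ p, AddCommGroup (E p)]
  [∀ p, Module ℝ (E p)] [∀ p, TopologicalSpace (E p)] [TopologicalSpace (TotalSpace F2 E)]
  [FiberBundle F2 E] [VectorBundle ℝ F2 E]

theorem isQuotientMap_frameProj : Topology.IsQuotientMap (frameProj E) := isQuotientMap_quotient_mk'

theorem frameProj_out (z : FrameQuotient E) : frameProj E z.out = z := Quotient.out_eq z

theorem frameProj_act (b : FrameBundle E) {g : GL (Fin 2) ℝ} (hg : g ∈ CO2) :
    frameProj E (b.act g) = frameProj E b :=
  (Quotient.sound (s := orbitSetoid E) ⟨g, hg, rfl⟩).symm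

theorem frameProj_eq_iff {b b' : FrameBundle E} :
    frameProj E b = frameProj E b' ↔ ∃ g ∈ CO2, b' = b.act g := Quotient.eq (r := orbitSetoid E)

theorem frameProj_surjective : Function.Surjective (frameProj E) := Quotient.mk_surjective

/-- The frames over the domain at `p` form a saturated set. -/
theorem mem_slopeDomain_of_frameProj_eq {p : M} {b b' : FrameBundle E}
    (h : frameProj E b = frameProj E b') (hb : b ∈ slopeDomain E k p) : b' ∈ slopeDomain E k p := by
  obtain ⟨g, -, rfl⟩ := frameProj_eq_iff.1 h
  exact hb

/-- By saturation the condition on the chosen representative does not depend on the choice, so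
openness and continuity on the quotient can be tested on B(E). -/
theorem preimage_out_slopeDomain (p : M) :
    frameProj E ⁻¹' {z | z.out ∈ slopeDomain E k p} = slopeDomain E k p :=
  Set.ext fun _ => ⟨mem_slopeDomain_of_frameProj_eq (frameProj_out _),
    mem_slopeDomain_of_frameProj_eq (frameProj_out _).symm⟩

theorem slopeCoord_out {p : M} {c : FrameBundle E} (hc : c ∈ slopeDomain E k p) :
    slopeCoord E k p (frameProj E c).out = slopeCoord E k p c :=
  (slopeCoord_eq_iff (mem_slopeDomain_of_frameProj_eq (frameProj_out _).symm hc) hc).2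
    (frameProj_out _)

variable [IsManifold (𝓡 (k + 1)) ∞ M] [ContMDiffVectorBundle ∞ F2 E (𝓡 (k + 1))]

/-- The chart of `B(E)/CO(2)` around the orbit of `b`. -/
def slopeChart (b : FrameBundle E) :
    OpenPartialHomeomorph (FrameQuotient E) (EuclideanSpace ℝ (Fin (k + 3))) where
  toFun z := slopeCoord E k b.1.proj z.out
  -- Every nonzero second coordinate yields the same orbit, so 1 will do; the final argument b is
  -- only the default value of the section.
  invFun t := frameProj E (slopeSection E k b.1.proj 1 b t)
  source := {z | z.out ∈ slopeDomain E k b.1.proj}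
  target := slopeTarget E k b.1.proj
  map_source' _ hz := slopeCoord_mem_slopeTarget hz
  map_target' _ ht := mem_slopeDomain_of_frameProj_eq (frameProj_out _).symm
    (slopeSection_mem_slopeDomain ht one_ne_zero b)
  left_inv' z hz := by
    have ht := slopeCoord_mem_slopeTarget hz
    conv_rhs => rw [← frameProj_out z]
    exact (slopeCoord_eq_iff (slopeSection_mem_slopeDomain ht one_ne_zero b) hz).1
      (slopeCoord_slopeSection ht one_ne_zero b)
  right_inv' t ht := by
    have hs := slopeSection_mem_slopeDomain ht one_ne_zero b
    rw [(slopeCoord_eq_iff (mem_slopeDomain_of_frameProj_eq (frameProj_out _).symm hs) hs).2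
      (frameProj_out _)]
    exact slopeCoord_slopeSection ht one_ne_zero b
  open_source := by
    rw [← isQuotientMap_frameProj.isOpen_preimage, preimage_out_slopeDomain]
    exact isOpen_slopeDomain
  open_target := isOpen_slopeTarget
  continuousOn_toFun := by
    have ho : IsOpen {z : FrameQuotient E | z.out ∈ slopeDomain E k b.1.proj} := by
      rw [← isQuotientMap_frameProj.isOpen_preimage, preimage_out_slopeDomain]
      exact isOpen_slopeDomain
    rw [isQuotientMap_frameProj.continuousOn_isOpen_iff ho, preimage_out_slopeDomain]
    have hc : ContinuousOn (slopeCoord E k b.1.proj) (slopeDomain E k b.1.proj) := fun c hc =>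
      (contMDiffAt_slopeCoord hc).continuousAt.continuousWithinAt
    exact hc.congr fun c hc => slopeCoord_out hc
  continuousOn_invFun := fun t ht =>
    (isQuotientMap_frameProj.continuous.continuousAt.comp
      (contMDiffAt_slopeSection ht one_ne_zero b).continuousAt).continuousWithinAt

theorem slopeChart_frameProj {b c : FrameBundle E} (hc : c ∈ slopeDomain E k b.1.proj) :
    slopeChart (k := k) b (frameProj E c) = slopeCoord E k b.1.proj c := slopeCoord_out hc

theorem frameProj_mem_slopeChart_source {b c : FrameBundle E} :
    frameProj E c ∈ (slopeChart (k := k) b).source ↔ c ∈ slopeDomain E k b.1.proj :=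
  Set.ext_iff.1 (preimage_out_slopeDomain b.1.proj) c

theorem mem_slopeDomain_self (b : FrameBundle E) : b ∈ slopeDomain E k b.1.proj :=
  ⟨mem_chart_source _ _, mem_baseSet_trivializationAt F2 E _⟩

variable (k E) in
/-- The atlas of `B(E)/CO(2)`. -/
@[reducible]
def frameQuotientChartedSpace :
    ChartedSpace (EuclideanSpace ℝ (Fin (k + 3))) (FrameQuotient E) where
  atlas := Set.range (slopeChart (k := k) (E := E))
  chartAt z := slopeChart z.out
  mem_chart_source z := mem_slopeDomain_self z.out
  chart_mem_atlas z := ⟨z.out, rfl⟩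

-- The transition maps are slope coordinates composed with slope sections, and both factors are
-- smooth for the structure of B(E).
variable (k E) in
theorem isManifold_frameQuotient :
    letI := frameQuotientChartedSpace k E
    IsManifold (𝓡 (k + 3)) ∞ (FrameQuotient E) := by
  letI := frameQuotientChartedSpace k E
  apply isManifold_of_contDiffOn
  rintro _ _ ⟨b, rfl⟩ ⟨b', rfl⟩ t ht
  have ht1 : t ∈ slopeTarget E k b.1.proj := ht.1.1
  have ht2 : slopeSection E k b.1.proj 1 b t ∈ slopeDomain E k b'.1.proj :=
    frameProj_mem_slopeChart_source.1 ht.1.2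
  have h1 := (contMDiffAt_slopeCoord ht2).comp t (contMDiffAt_slopeSection ht1 one_ne_zero b)
  refine (contMDiffAt_iff_contDiffAt.1 h1).contDiffWithinAt.congr ?_ ?_
  · intro s hs
    exact slopeChart_frameProj (frameProj_mem_slopeChart_source.1 hs.1.2)
  · exact slopeChart_frameProj ht2

theorem isSmoothSubmersion_frameProj :
    letI := frameQuotientChartedSpace k E
    IsSmoothSubmersion (modelB k) (𝓡 (k + 3)) (frameProj E) := by
  letI := frameQuotientChartedSpace k E
  haveI := isManifold_frameQuotient k E
  have hchart : ∀ z : FrameQuotient E,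
      slopeChart (k := k) z.out ∈ IsManifold.maximalAtlas (𝓡 (k + 3)) ∞ (FrameQuotient E) :=
    fun z => IsManifold.chart_mem_maximalAtlas z
  -- The preferred chart is centred at a chosen representative of the orbit, which need not be b,
  -- but b has the same base point.
  have hdom : ∀ b : FrameBundle E, b ∈ slopeDomain E k (frameProj E b).out.1.proj := fun b =>
    mem_slopeDomain_of_frameProj_eq (frameProj_out _) (mem_slopeDomain_self _)
  refine isSmoothSubmersion_of_charts fun b => ?_
  have hb := hdom b
  have ht := slopeCoord_mem_slopeTarget hb
  have hc := complexCoord_one_ne_zero ((mem_frameOpens_iff_slope hb.2).1 b.2)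
  refine ⟨slopeChart (frameProj E b).out, hchart _, slopeCoord E k (frameProj E b).out.1.proj,
    slopeSection E k (frameProj E b).out.1.proj _ b, contMDiffAt_slopeCoord hb, ht,
    contMDiffAt_slopeSection ht hc b, slopeSection_slopeCoord hb b, ?_, ?_⟩
  · filter_upwards [isOpen_slopeDomain.mem_nhds hb] with c hc
    rw [← slopeChart_frameProj hc,
      (slopeChart (frameProj E b).out).left_inv (frameProj_mem_slopeChart_source.2 hc)]
  · filter_upwards [isOpen_slopeTarget.mem_nhds ht] with s hs
    have hs' := slopeSection_mem_slopeDomain hs hc b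
    have := (slopeChart (k := k) (frameProj E b).out).left_inv
      (frameProj_mem_slopeChart_source.2 hs')
    rw [slopeChart_frameProj hs', slopeCoord_slopeSection hs hc] at this
    exact this.symm

end QuotientManifold

/-! ### Tangent maps and local sections of submersions -/

section LocalSection

variable {V₁ H₁ V₂ H₂ : Type*} [NormedAddCommGroup V₁] [NormedSpace ℝ V₁]
  [TopologicalSpace H₁] [NormedAddCommGroup V₂] [NormedSpace ℝ V₂] [TopologicalSpace H₂]
  {I₁ : ModelWithCorners ℝ V₁ H₁} {I₂ : ModelWithCorners ℝ V₂ H₂} {N₁ N₂ : Type*}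
  [TopologicalSpace N₁] [ChartedSpace H₁ N₁] [TopologicalSpace N₂] [ChartedSpace H₂ N₂]

/-- The tangent map of a map that is smooth at a point is smooth over this point. -/
theorem contMDiffAt_tangentMap [IsManifold I₁ ∞ N₁] [IsManifold I₂ ∞ N₂] {f : N₁ → N₂}
    {v : TangentBundle I₁ N₁} (hf : ContMDiffAt I₁ I₂ ∞ f v.proj) :
    ContMDiffAt I₁.tangent I₂.tangent ∞ (tangentMap I₁ I₂ f) v := by
  haveI : IsManifold I₁ 1 N₁ := IsManifold.of_le (n := ∞) (by simp)
  haveI : IsManifold I₂ 1 N₂ := IsManifold.of_le (n := ∞) (by simp)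
  let b₁ : TangentBundle I₁ N₁ → N₁ := fun p => p.1
  let w : Π (y : TangentBundle I₁ N₁), TangentSpace I₁ (b₁ y) := fun y => y.2
  have hw : ContMDiffAt I₁.tangent I₁.tangent ∞ (fun y => (w y : TangentBundle I₁ N₁)) v :=
    contMDiffAt_id
  let b₂ : TangentBundle I₁ N₁ → N₂ := f ∘ b₁
  have hb₂ : ContMDiffAt I₁.tangent I₂ ∞ b₂ v := hf.comp v (contMDiffAt_proj (TangentSpace I₁))
  let ϕ : Π (y : TangentBundle I₁ N₁), TangentSpace I₁ (b₁ y) →L[ℝ] TangentSpace I₂ (b₂ y) :=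
    fun y => mfderiv I₁ I₂ f (b₁ y)
  have hϕ : ContMDiffAt I₁.tangent 𝓘(ℝ, V₁ →L[ℝ] V₂) ∞
      (fun y => ContinuousLinearMap.inCoordinates V₁ (TangentSpace I₁ (M := N₁)) V₂
        (TangentSpace I₂ (M := N₂)) (b₁ v) (b₁ y) (b₂ v) (b₂ y) (ϕ y)) v := by
    have A : ContMDiffAt I₁ 𝓘(ℝ, V₁ →L[ℝ] V₂) ∞
        (fun y => ContinuousLinearMap.inCoordinates V₁ (TangentSpace I₁ (M := N₁)) V₂
        (TangentSpace I₂ (M := N₂)) (b₁ v) y (b₂ v) (f y) (mfderiv I₁ I₂ f y)) (b₁ v) :=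
      ContMDiffAt.mfderiv_const hf (by simp)
    exact A.comp v (contMDiffAt_proj (TangentSpace I₁))
  exact ContMDiffAt.clm_apply_of_inCoordinates hϕ hw hb₂

/-- A smooth submersion has smooth local sections through every point. -/
theorem IsSmoothSubmersion.exists_localSection [I₁.Boundaryless] [I₂.Boundaryless]
    [IsManifold I₁ ∞ N₁] [IsManifold I₂ ∞ N₂] [FiniteDimensional ℝ V₂] {f : N₁ → N₂}
    (hf : IsSmoothSubmersion I₁ I₂ f) (x : N₁) :
    ∃ σ : N₂ → N₁, ContMDiffAt I₂ I₁ ∞ σ (f x) ∧ σ (f x) = x ∧ ∀ᶠ z in 𝓝 (f x), f (σ z) = z := by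
  haveI : CompleteSpace V₂ := FiniteDimensional.complete ℝ V₂
  set φ := extChartAt I₁ x with hφ
  set ψ := extChartAt I₂ (f x) with hψ
  set F : V₁ → V₂ := ψ ∘ f ∘ φ.symm with hF
  have hFsm : ContDiffAt ℝ ∞ F (φ x) := by
    have := (contMDiffAt_iff.1 (hf.contMDiff x)).2
    rwa [I₁.range_eq_univ, contDiffWithinAt_univ] at this
  have hFd : mfderiv I₁ I₂ f x = fderiv ℝ F (φ x) := by
    rw [((hf.contMDiff x).mdifferentiableAt (by simp)).mfderiv, I₁.range_eq_univ,
      fderivWithin_univ]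
    rfl
  have hsurj : Function.Surjective (fderiv ℝ F (φ x)) := by
    have := hf.surjective_mfderiv x
    rw [hFd] at this
    exact this
  -- On the slice φ x + L w through a linear right inverse L of the differential, F has derivative
  -- the identity at w = 0, so the inverse function theorem applies.
  obtain ⟨L, hL⟩ := (fderiv ℝ F (φ x)).toLinearMap.exists_rightInverse_of_surjective
    (LinearMap.range_eq_top.2 hsurj)
  set L' : V₂ →L[ℝ] V₁ := LinearMap.toContinuousLinearMap L with hL'
  set G : V₂ → V₂ := fun w => F (φ x + L' w) with hG
  have hinner : ContDiff ℝ ∞ fun w => φ x + L' w := contDiff_const.add L'.contDiff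
  have h0 : φ x + L' 0 = φ x := by simp
  have hGsm : ContDiffAt ℝ ∞ G 0 := ContDiffAt.comp (g := F) (0 : V₂) (by rwa [h0]) hinner.contDiffAt
  have hGd : HasFDerivAt G ((ContinuousLinearEquiv.refl ℝ V₂ : V₂ ≃L[ℝ] V₂) : V₂ →L[ℝ] V₂) 0 := by
    have h1 : HasFDerivAt F (fderiv ℝ F (φ x)) (φ x + L' 0) := by
      rw [h0]; exact (hFsm.differentiableAt (by simp)).hasFDerivAt
    have h2 : HasFDerivAt (fun w => φ x + L' w) L' 0 := L'.hasFDerivAt.const_add _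
    have h3 : (fderiv ℝ F (φ x)).comp L' = ContinuousLinearMap.id ℝ V₂ :=
      ContinuousLinearMap.ext fun w => LinearMap.congr_fun hL w
    have h4 := HasFDerivAt.comp (g := F) (0 : V₂) h1 h2
    rw [h3] at h4
    exact h4
  have hG0 : G 0 = ψ (f x) := by
    simp only [hG, h0, hF, Function.comp_apply]
    rw [hφ, extChartAt_to_inv]
  set h := hGsm.localInverse hGd (by simp) with hh
  have hsm : ContDiffAt ℝ ∞ h (ψ (f x)) := by
    rw [← hG0]; exact hGsm.to_localInverse hGd (by simp)
  have hh0 : h (ψ (f x)) = 0 := by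
    rw [← hG0]; exact hGsm.localInverse_apply_image hGd (by simp)
  have hinv : ∀ᶠ y in 𝓝 (ψ (f x)), G (h y) = y := by
    rw [← hG0]
    exact (hGsm.hasStrictFDerivAt' hGd (by simp)).eventually_right_inverse
  refine ⟨fun z => φ.symm (φ x + L' (h (ψ z))), ?_, ?_, ?_⟩
  · have h1 : ContMDiffAt I₂ 𝓘(ℝ, V₁) ∞ (fun z => φ x + L' (h (ψ z))) (f x) :=
      (ContDiffAt.comp (ψ (f x)) hinner.contDiffAt hsm).contMDiffAt.comp (f x)
        contMDiffAt_extChartAt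
    have h2 : ContMDiffAt 𝓘(ℝ, V₁) I₁ ∞ φ.symm (φ x + L' (h (ψ (f x)))) := by
      rw [hh0, h0]
      exact (contMDiffOn_extChartAt_symm x).contMDiffAt (extChartAt_target_mem_nhds x)
    exact h2.comp (f x) h1
  · simp only [hh0, h0]
    exact extChartAt_to_inv x
  · have hcont : ContinuousAt (fun z => f (φ.symm (φ x + L' (h (ψ z))))) (f x) := by
      have h1 : ContinuousAt (fun z => φ x + L' (h (ψ z))) (f x) :=
        ContinuousAt.comp (f := ψ) (x := f x) (g := fun y => φ x + L' (h y))
          (continuousAt_const.add (L'.continuous.continuousAt.comp hsm.continuousAt))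
          (continuousAt_extChartAt (f x))
      have h2 : ContinuousAt φ.symm (φ x + L' (h (ψ (f x)))) := by
        rw [hh0, h0]; exact continuousAt_extChartAt_symm x
      exact hf.contMDiff.continuous.continuousAt.comp
        (ContinuousAt.comp (f := fun z => φ x + L' (h (ψ z))) h2 h1)
    -- The section identity is known only after applying ψ; injectivity of ψ gives it on the
    -- manifold once both points lie in the source.
    have hsrc : ∀ᶠ z in 𝓝 (f x), f (φ.symm (φ x + L' (h (ψ z)))) ∈ ψ.source := by
      apply hcont.eventually_mem
      simp only [hh0, h0]
      rw [hφ, extChartAt_to_inv]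
      exact extChartAt_source_mem_nhds (f x)
    filter_upwards [hsrc, extChartAt_source_mem_nhds (I := I₂) (f x),
      (continuousAt_extChartAt (I := I₂) (f x)).eventually hinv] with z h1 h2 h3
    exact ψ.injOn h1 h2 h3

end LocalSection

/-! ### Smooth families of linear equations -/

section LinearFamilies

variable {V₁ H₁ : Type*} [NormedAddCommGroup V₁] [NormedSpace ℝ V₁]
  [TopologicalSpace H₁] {I : ModelWithCorners ℝ V₁ H₁} {N : Type*}
  [TopologicalSpace N] [ChartedSpace H₁ N]
  {V W : Type*} [NormedAddCommGroup V] [NormedSpace ℝ V] [FiniteDimensional ℝ V]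
  [NormedAddCommGroup W] [NormedSpace ℝ W]

/-- A family of linear maps that is pointwise smooth is smooth in the operator topology. -/
theorem contMDiffAt_toContinuousLinearMap {A : N → V →ₗ[ℝ] W} {z : N}
    (hA : ∀ v, ContMDiffAt I 𝓘(ℝ, W) ∞ (fun z => A z v) z) :
    ContMDiffAt I 𝓘(ℝ, V →L[ℝ] W) ∞ (fun z => LinearMap.toContinuousLinearMap (A z)) z := by
  let b := Module.finBasis ℝ V
  -- A z is the sum of the operators v ↦ (i-th coordinate of v) A z (b i), so the values on a finite
  -- basis control the operator.
  have h : (fun z => LinearMap.toContinuousLinearMap (A z)) = fun z =>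
      ∑ i, ContinuousLinearMap.smulRightL ℝ V W (LinearMap.toContinuousLinearMap (b.coord i))
        (A z (b i)) := by
    funext z
    ext v
    simp only [FunLike.coe_sum, Finset.sum_apply, LinearMap.coe_toContinuousLinearMap',
      ContinuousLinearMap.smulRightL_apply_apply]
    conv_lhs => rw [← b.sum_repr v, map_sum]
    simp
  rw [h]
  exact ContMDiffAt.sum fun i _ =>
    (ContinuousLinearMap.contDiff _).contMDiff.contMDiffAt.comp z (hA (b i))

/-- The solution of a smooth family of invertible linear equations is smooth. -/
theorem contMDiffAt_of_linear_eq {A : N → V →ₗ[ℝ] W} {u : N → V} {y : N → W} {z : N}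
    (hA : ∀ v, ContMDiffAt I 𝓘(ℝ, W) ∞ (fun z => A z v) z)
    (hbij : ∀ᶠ z' in 𝓝 z, Function.Bijective (A z')) (hy : ContMDiffAt I 𝓘(ℝ, W) ∞ y z)
    (h : ∀ᶠ z' in 𝓝 z, A z' (u z') = y z') : ContMDiffAt I 𝓘(ℝ, V) ∞ u z := by
  haveI : CompleteSpace V := FiniteDimensional.complete ℝ V
  haveI : FiniteDimensional ℝ W :=
    (LinearEquiv.ofBijective (A z) hbij.self_of_nhds).finiteDimensional
  have hequiv : ∀ z', Function.Bijective (A z') →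
      ∃ e : V ≃L[ℝ] W, (e : V →L[ℝ] W) = LinearMap.toContinuousLinearMap (A z') := fun z' hz' =>
    ⟨(LinearEquiv.ofBijective (A z') hz').toContinuousLinearEquiv, by ext v; rfl⟩
  -- Inversion is smooth at an invertible operator. The default value of `inverse` at other
  -- operators plays no role, since A is bijective near z.
  have hinv : ContMDiffAt I 𝓘(ℝ, W →L[ℝ] V) ∞
      (fun z => (LinearMap.toContinuousLinearMap (A z)).inverse) z := by
    obtain ⟨e, he⟩ := hequiv z hbij.self_of_nhds
    have h1 := contDiffAt_map_inverse (n := ∞) e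
    rw [he] at h1
    exact h1.contMDiffAt.comp z (contMDiffAt_toContinuousLinearMap hA)
  refine (hinv.clm_apply hy).congr_of_eventuallyEq ?_
  filter_upwards [hbij, h] with z' h1 h2
  obtain ⟨e, he⟩ := hequiv z' h1
  rw [← he, ContinuousLinearMap.inverse_equiv, ← h2]
  have : A z' (u z') = e (u z') := (DFunLike.congr_fun he (u z')).symm
  rw [this]
  exact (e.symm_apply_apply _).symm

end LinearFamilies

/-! ### Symmetric products and homogeneous polynomials -/

section Monomials

variable {W : Type*} [AddCommGroup W] [Module ℝ W]

/-- The product of `k` variables, as an element of `V[k]`. -/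
def prodX {k : ℕ} (f : Fin k → Fin 2) : V k :=
  ⟨∏ l, MvPolynomial.X (f l), by
    have := MvPolynomial.IsHomogeneous.prod Finset.univ
      (fun l => (MvPolynomial.X (f l) : MvPolynomial (Fin 2) ℝ)) (fun _ => 1)
      (fun l _ => MvPolynomial.isHomogeneous_X ℝ (f l))
    simpa using this⟩

/-- V[k] is the k-th power of the space V[1], which is spanned by the variables. -/
theorem span_range_prodX (k : ℕ) : Submodule.span ℝ (Set.range (prodX (k := k))) = ⊤ := by
  apply Submodule.map_injective_of_injective (V k).injective_subtype
  rw [Submodule.map_span, Submodule.map_top, Submodule.range_subtype]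
  change _ = MvPolynomial.homogeneousSubmodule (Fin 2) ℝ k
  rw [← MvPolynomial.homogeneousSubmodule_one_pow, MvPolynomial.homogeneousSubmodule_one_eq_span_X,
    Submodule.span_pow]
  congr 1
  ext P
  rw [Set.mem_pow]
  constructor
  · rintro ⟨_, ⟨f, rfl⟩, rfl⟩
    refine ⟨fun l => ⟨MvPolynomial.X (f l), f l, rfl⟩, ?_⟩
    rw [List.prod_ofFn]; rfl
  · rintro ⟨f, rfl⟩
    choose g hg using fun l => (f l).2
    refine ⟨_, ⟨g, rfl⟩, ?_⟩
    rw [List.prod_ofFn]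
    change ∏ l, MvPolynomial.X (g l) = _
    exact Finset.prod_congr rfl fun l _ => hg l

/-- Homogeneous polynomials depend linearly on coefficients of products of variables. -/
theorem exists_coeff_prodX (k : ℕ) : ∃ R : V k →ₗ[ℝ] ((Fin k → Fin 2) → ℝ),
    ∀ P, ∑ f, R P f • prodX f = P := by
  -- For k > 1 the 2^k words in the variables are dependent, so the coefficients R are a choice of
  -- right inverse.
  obtain ⟨R, hR⟩ := (Fintype.linearCombination ℝ (prodX (k := k))).exists_rightInverse_of_surjective
    (by rw [Fintype.range_linearCombination, span_range_prodX])
  exact ⟨R, fun P => LinearMap.congr_fun hR P⟩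

theorem equivMvPolynomial_ι (b : Module.Basis (Fin 2) ℝ W) (w : W) :
    SymmetricAlgebra.equivMvPolynomial b (SymmetricAlgebra.ι ℝ W w)
      = ∑ j, MvPolynomial.C (b.repr w j) * MvPolynomial.X j := by
  conv_lhs => rw [← b.sum_repr w]
  simp only [map_sum, map_smul, SymmetricAlgebra.equivMvPolynomial_ι_apply,
    MvPolynomial.smul_eq_C_mul]

theorem coe_polyEquiv {k : ℕ} (b : Module.Basis (Fin 2) ℝ W) (s : SymPow k W) :
    (polyEquiv k b s : MvPolynomial (Fin 2) ℝ) = SymmetricAlgebra.equivMvPolynomial b s := rfl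

theorem polyEquiv_symProd {k : ℕ} (b : Module.Basis (Fin 2) ℝ W) (w : Fin k → W) :
    polyEquiv k b (symProd w)
      = ∑ r : Fin k → Fin 2, (∏ l, b.repr (w l) (r l)) • prodX r := by
  apply Subtype.ext
  rw [coe_polyEquiv]
  simp only [symProd, map_prod, equivMvPolynomial_ι, Finset.prod_univ_sum, Fintype.piFinset_univ,
    Submodule.coe_sum, Submodule.coe_smul, prodX, MvPolynomial.smul_eq_C_mul,
    Finset.prod_mul_distrib]

theorem polyEquiv_symProd_basis {k : ℕ} (b : Module.Basis (Fin 2) ℝ W) (f : Fin k → Fin 2) :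
    polyEquiv k b (symProd (b ∘ f)) = prodX f := by
  apply Subtype.ext
  rw [coe_polyEquiv]
  simp [symProd, prodX, SymmetricAlgebra.equivMvPolynomial_ι_apply]

end Monomials

/-! ### Polynomial coordinates of tangent vectors of M -/

section SolderingForm

variable {k : ℕ} {M : Type*} [TopologicalSpace M]
  [ChartedSpace (EuclideanSpace ℝ (Fin (k + 1))) M] [IsManifold (𝓡 (k + 1)) ∞ M]
  {E : M → Type*} [∀ p, AddCommGroup (E p)]
  [∀ p, Module ℝ (E p)] [∀ p, TopologicalSpace (E p)] [TopologicalSpace (TotalSpace F2 E)]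
  [FiberBundle F2 E] [VectorBundle ℝ F2 E]

variable (E) in
/-- The local frame of `E` over the trivialization domain at `p₀`. -/
def localPair (p₀ : M) (i : Fin 2) (p : M) : E p :=
  (trivializationAt F2 E p₀).localFrame (EuclideanSpace.basisFun (Fin 2) ℝ).toBasis i p

theorem trivializationAt_localPair {p₀ p : M} (hp : p ∈ (trivializationAt F2 E p₀).baseSet)
    (i : Fin 2) : (trivializationAt F2 E p₀ ⟨p, localPair E p₀ i p⟩).2
      = EuclideanSpace.basisFun (Fin 2) ℝ i := by
  rw [localPair, Trivialization.localFrame_apply_of_mem_baseSet _ _ hp, Trivialization.basisAt,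
    Module.Basis.map_apply]
  exact ((trivializationAt F2 E p₀).linearEquivAt ℝ p hp).apply_symm_apply _

/-- The tangent vector with given polynomial coordinates in the local frame of `E`. -/
def polyVector (S : GL2Structure k M E) (R : V k →ₗ[ℝ] ((Fin k → Fin 2) → ℝ)) (p₀ p : M) :
    V k →ₗ[ℝ] TangentSpace (𝓡 (k + 1)) p :=
  ∑ f : Fin k → Fin 2, (LinearMap.proj f ∘ₗ R).smulRight
    ((S.iso p).symm (symProd fun l => localPair E p₀ (f l) p))

theorem polyVector_apply (S : GL2Structure k M E) (R : V k →ₗ[ℝ] ((Fin k → Fin 2) → ℝ)) (p₀ p : M)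
    (P : V k) : polyVector S R p₀ p P
      = ∑ f : Fin k → Fin 2, R P f • (S.iso p).symm (symProd fun l => localPair E p₀ (f l) p) := by
  simp [polyVector]

/-- Whatever the choice of R, this is the inverse of the isomorphism TM ≅ S^k(E) followed by the
polynomial coordinates of the local frame. It is written with symmetric products because `S.smooth`
speaks only of these. -/
theorem polyVector_bijective (S : GL2Structure k M E) {R : V k →ₗ[ℝ] ((Fin k → Fin 2) → ℝ)}
    (hR : ∀ P, ∑ f, R P f • prodX f = P) {p₀ p : M}
    (hp : p ∈ (trivializationAt F2 E p₀).baseSet) : Function.Bijective (polyVector S R p₀ p) := by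
  set c := (trivializationAt F2 E p₀).basisAt (EuclideanSpace.basisFun (Fin 2) ℝ).toBasis hp
  have hc : ∀ f : Fin k → Fin 2, (fun l => localPair E p₀ (f l) p) = c ∘ f := fun f => by
    funext l
    exact Trivialization.localFrame_apply_of_mem_baseSet _ _ hp
  have h : ∀ P, polyVector S R p₀ p P = (S.iso p).symm ((polyEquiv k c).symm P) := fun P => by
    conv_rhs => rw [← hR P]
    simp only [polyVector_apply, map_sum, map_smul]
    refine Finset.sum_congr rfl fun f _ => ?_
    rw [hc f, ← polyEquiv_symProd_basis c f, LinearEquiv.symm_apply_apply]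
  rw [show ⇑(polyVector S R p₀ p) = (S.iso p).symm ∘ (polyEquiv k c).symm from funext h]
  exact (S.iso p).symm.bijective.comp (polyEquiv k c).symm.bijective

variable [ContMDiffVectorBundle ∞ F2 E (𝓡 (k + 1))]

/-- The polynomial coordinates of a tangent vector in a local frame of `E` are smooth. -/
theorem exists_contMDiffAt_polyCoords (S : GL2Structure k M E)
    {R : V k →ₗ[ℝ] ((Fin k → Fin 2) → ℝ)} (hR : ∀ P, ∑ f, R P f • prodX f = P)
    {ι : Type*} [Fintype ι] (B : Module.Basis ι ℝ (V k)) (v₀ : TangentBundle (𝓡 (k + 1)) M) :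
    ∃ u : TangentBundle (𝓡 (k + 1)) M → (ι → ℝ),
      ContMDiffAt (𝓡 (k + 1)).tangent 𝓘(ℝ, ι → ℝ) ∞ u v₀ ∧
      ∀ᶠ v in 𝓝 v₀, polyVector S R v₀.proj v.proj (B.equivFun.symm (u v)) = v.snd := by
  set e := trivializationAt F2 E v₀.proj
  set eT := trivializationAt (EuclideanSpace ℝ (Fin (k + 1))) (TangentSpace (𝓡 (k + 1))) v₀.proj
    with heT
  -- The value 0 outside the trivialization domain is arbitrary; only a neighbourhood of v₀ matters.
  have hex : ∀ v : TangentBundle (𝓡 (k + 1)) M, ∃ c : ι → ℝ, v.proj ∈ e.baseSet →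
      polyVector S R v₀.proj v.proj (B.equivFun.symm c) = v.snd := fun v => by
    by_cases hv : v.proj ∈ e.baseSet
    · obtain ⟨P, hP⟩ := (polyVector_bijective S hR hv).2 v.snd
      exact ⟨B.equivFun P, fun _ => by rw [LinearEquiv.symm_apply_apply, hP]⟩
    · exact ⟨0, fun h => absurd h hv⟩
  choose u hu using hex
  have hproj : ContMDiff (𝓡 (k + 1)).tangent (𝓡 (k + 1)) ∞
      (fun v : TangentBundle (𝓡 (k + 1)) M => v.proj) := contMDiff_proj (TangentSpace (𝓡 (k + 1)))
  have hbase : ∀ᶠ v in 𝓝 v₀, v.proj ∈ e.baseSet :=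
    hproj.continuous.continuousAt.eventually_mem
      (e.open_baseSet.mem_nhds (mem_baseSet_trivializationAt F2 E v₀.proj))
  have hbaseT : ∀ᶠ v in 𝓝 v₀, v.proj ∈ eT.baseSet :=
    hproj.continuous.continuousAt.eventually_mem
      (eT.open_baseSet.mem_nhds (mem_baseSet_trivializationAt _ _ v₀.proj))
  have hsnd : ∀ {g : TangentBundle (𝓡 (k + 1)) M → TangentBundle (𝓡 (k + 1)) M},
      ContMDiffAt (𝓡 (k + 1)).tangent (𝓡 (k + 1)).tangent ∞ g v₀ → (∀ v, (g v).proj = v.proj) →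
      ContMDiffAt (𝓡 (k + 1)).tangent 𝓘(ℝ, EuclideanSpace ℝ (Fin (k + 1))) ∞
        (fun v => eT.continuousLinearMapAt ℝ (g v).proj (g v).snd) v₀ := by
    intro g hg hgp
    have h1 := (contMDiffAt_totalSpace.1 hg).2
    rw [hgp v₀] at h1
    refine h1.congr_of_eventuallyEq ?_
    filter_upwards [hbaseT] with v hv
    have hv' : (g v).proj ∈ eT.baseSet := by rw [hgp]; exact hv
    exact Trivialization.continuousLinearMapAt_apply_of_mem _ eT hv' (g v).snd
  -- Read in a trivialization of TM, u solves a square linear system; its coefficients are smooth by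
  -- `S.smooth` applied to symmetric products of the local frame.
  refine ⟨u, contMDiffAt_of_linear_eq
    (A := fun v => (eT.continuousLinearMapAt ℝ v.proj).toLinearMap ∘ₗ
      polyVector S R v₀.proj v.proj ∘ₗ B.equivFun.symm.toLinearMap)
    (y := fun v => eT.continuousLinearMapAt ℝ v.proj v.snd) ?_ ?_ ?_ ?_, ?_⟩
  · intro c
    simp only [LinearMap.comp_apply, polyVector_apply, map_sum, map_smul]
    refine ContMDiffAt.sum fun f _ => ?_
    have h1 := (S.smooth e.baseSet e.open_baseSet (fun l => localPair E v₀.proj (f l))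
      (fun l => e.contMDiffOn_localFrame_baseSet ∞ _ (f l))).contMDiffAt
        (e.open_baseSet.mem_nhds (mem_baseSet_trivializationAt F2 E v₀.proj))
    have h2 := hsnd (h1.comp v₀ hproj.contMDiffAt) fun _ => rfl
    have h3 : ContMDiffAt (𝓡 (k + 1)).tangent 𝓘(ℝ, ℝ) ∞
        (fun _ : TangentBundle (𝓡 (k + 1)) M => R (B.equivFun.symm c) f) v₀ := contMDiffAt_const
    exact h3.smul h2
  · filter_upwards [hbase, hbaseT] with v h1 h2
    have h3 : Function.Bijective (eT.continuousLinearMapAt ℝ v.proj) := by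
      rw [← Trivialization.coe_continuousLinearEquivAt_eq eT h2]
      exact (eT.continuousLinearEquivAt ℝ v.proj h2).bijective
    exact (h3.comp (polyVector_bijective S hR h1)).comp B.equivFun.symm.bijective
  · exact hsnd contMDiffAt_id fun _ => rfl
  · filter_upwards [hbase] with v h1
    simp only [LinearMap.comp_apply]
    exact congrArg _ (hu v h1)
  · filter_upwards [hbase] with v h1
    exact hu v h1

end SolderingForm

/-! ### Smoothness of the forms ξ -/

section Expansion

variable {V₁ H₁ : Type*} [NormedAddCommGroup V₁] [NormedSpace ℝ V₁]
  [TopologicalSpace H₁] {I : ModelWithCorners ℝ V₁ H₁} {N : Type*}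
  [TopologicalSpace N] [ChartedSpace H₁ N]

/-- This is the shape of ξ in local terms: u holds the coordinates of the projected vector in a
basis of V[k], R writes the basis in words, a expresses the local frame in the moving frame, and z
holds the constant values of ξ on words. -/
theorem contMDiffAt_multilinear_expansion {k : ℕ} {ι : Type*} [Fintype ι] {u : N → ι → ℝ}
    {R : ι → (Fin k → Fin 2) → ℝ} {a : Fin 2 → Fin 2 → N → ℝ} {z : (Fin k → Fin 2) → ℂ} {x : N}
    (hu : ContMDiffAt I 𝓘(ℝ, ι → ℝ) ∞ u x) (ha : ∀ i j, ContMDiffAt I 𝓘(ℝ, ℝ) ∞ (a i j) x) :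
    ContMDiffAt I 𝓘(ℝ, ℂ) ∞
      (fun v => ∑ m, u v m • ∑ f, R m f • ∑ r, (∏ l, a (f l) (r l) v) • z r) x := by
  refine ContMDiffAt.sum fun m _ => ?_
  have h1 : ContMDiffAt I 𝓘(ℝ, ℝ) ∞ (fun v => u v m) x :=
    ((ContinuousLinearMap.proj (R := ℝ) (φ := fun _ : ι => ℝ)
      m).contDiff.contMDiff.contMDiffAt).comp x hu
  refine ContMDiffAt.smul h1 (ContMDiffAt.sum fun f _ => ?_)
  have h2 : ContMDiffAt I 𝓘(ℝ, ℝ) ∞ (fun _ : N => R m f) x := contMDiffAt_const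
  refine ContMDiffAt.smul h2 (ContMDiffAt.sum fun r _ => ?_)
  have h3 : ContMDiffAt I 𝓘(ℝ, ℂ) ∞ (fun _ : N => z r) x := contMDiffAt_const
  exact ContMDiffAt.smul (contMDiffAt_finsetProd fun l _ => ha (f l) (r l)) h3

end Expansion

section SolderingForm

variable {k : ℕ} {M : Type*} [TopologicalSpace M]
  [ChartedSpace (EuclideanSpace ℝ (Fin (k + 1))) M] [IsManifold (𝓡 (k + 1)) ∞ M]
  {E : M → Type*} [∀ p, AddCommGroup (E p)]
  [∀ p, Module ℝ (E p)] [∀ p, TopologicalSpace (E p)] [TopologicalSpace (TotalSpace F2 E)]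
  [FiberBundle F2 E] [VectorBundle ℝ F2 E] [ContMDiffVectorBundle ∞ F2 E (𝓡 (k + 1))]

theorem FrameBundle.coe_basis (b : FrameBundle E) : ⇑b.basis = ![b.fst, b.snd] :=
  coe_basisOfLinearIndependentOfCardEqFinrank _ _

/-- The coordinates of a local frame of `E` in a variable frame are smooth. -/
theorem contMDiffAt_basis_repr (b₀ : FrameBundle E) (i j : Fin 2) :
    ContMDiffAt (modelB k) 𝓘(ℝ, ℝ) ∞
      (fun b : FrameBundle E => b.basis.repr (localPair E b₀.1.proj i b.1.proj) j) b₀ := by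
  set p₀ := b₀.1.proj with hp₀
  have hbase : ∀ᶠ b : FrameBundle E in 𝓝 b₀, b.1.proj ∈ (trivializationAt F2 E p₀).baseSet :=
    (contMDiff_frameBundle_proj (k := k) (E := E)).continuous.continuousAt.eventually_mem
      ((trivializationAt F2 E p₀).open_baseSet.mem_nhds (mem_baseSet_trivializationAt F2 E p₀))
  have hw := contMDiffAt_frameTriv_snd (k := k) (p := p₀) (b := b₀)
    (mem_baseSet_trivializationAt F2 E p₀)
  have key : ContMDiffAt (modelB k) 𝓘(ℝ, Fin 2 → ℝ) ∞ (fun b : FrameBundle E =>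
      (b.basis.repr (localPair E p₀ i b.1.proj) : Fin 2 → ℝ)) b₀ := by
    -- In the trivialization the local frame vector is the constant e_i, and the coordinates sought
    -- solve c_0 x + c_1 y = e_i for the moving frame (x, y).
    refine contMDiffAt_of_linear_eq
      (A := fun b : FrameBundle E => Fintype.linearCombination ℝ
        ![(frameTriv E p₀ b.1).2.1, (frameTriv E p₀ b.1).2.2])
      (y := fun _ => EuclideanSpace.basisFun (Fin 2) ℝ i) ?_ ?_ contMDiffAt_const ?_
    · intro c
      simp only [Fintype.linearCombination_apply, Fin.sum_univ_two, Matrix.cons_val_zero,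
        Matrix.cons_val_one]
      have h1 : ContDiff ℝ ∞ fun w : F2 × F2 => c 0 • w.1 + c 1 • w.2 := by fun_prop
      exact h1.contMDiff.contMDiffAt.comp b₀ hw
    · filter_upwards [hbase] with b hb
      have hli := (linearIndependent_pair_iff_slope _).2 ((mem_frameOpens_iff_slope hb).1 b.2)
      have hinj := linearIndependent_iff_injective_fintypeLinearCombination.1 hli
      exact ⟨hinj, (LinearMap.injective_iff_surjective_of_finrank_eq_finrank (by simp)).1 hinj⟩
    · filter_upwards [hbase] with b hb
      let L := (trivializationAt F2 E p₀).linearEquivAt ℝ b.1.proj hb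
      have h1 := b.basis.sum_repr (localPair E p₀ i b.1.proj)
      rw [b.coe_basis, Fin.sum_univ_two] at h1
      have h2 := congrArg L h1
      rw [map_add, map_smul, map_smul] at h2
      rw [Fintype.linearCombination_apply, Fin.sum_univ_two]
      exact h2.trans (trivializationAt_localPair hb i)
  exact ((ContinuousLinearMap.proj (R := ℝ) (φ := fun _ : Fin 2 => ℝ)
    j).contDiff.contMDiff.contMDiffAt).comp b₀ key


/-- The forms `ξ^{k,j}` are smooth. -/
theorem contMDiff_xi (S : GL2Structure k M E) (hk : Odd k) (j : Idx k) :
    ContMDiff (modelB k).tangent 𝓘(ℝ, ℂ) ∞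
      (fun v : TangentBundle (modelB k) (FrameBundle E) => xi S hk j v.proj v.snd) := by
  intro v₀
  obtain ⟨R, hR⟩ := exists_coeff_prodX k
  set B := adaptedBasis hk
  have hT : ContMDiff (modelB k).tangent (𝓡 (k + 1)).tangent ∞
      (tangentMap (modelB k) (𝓡 (k + 1)) (fun b : FrameBundle E => b.1.proj)) :=
    contMDiff_frameBundle_proj.contMDiff_tangentMap (by simp)
  obtain ⟨u, hu, hu'⟩ := exists_contMDiffAt_polyCoords S hR B
    (tangentMap (modelB k) (𝓡 (k + 1)) (fun b : FrameBundle E => b.1.proj) v₀)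
  have hu1 := hu.comp v₀ hT.contMDiffAt
  have hu2 := hT.continuous.continuousAt.eventually hu'
  have hproj : ContMDiff (modelB k).tangent (modelB k) ∞
      (fun v : TangentBundle (modelB k) (FrameBundle E) => v.proj) :=
    contMDiff_proj (TangentSpace (modelB k))
  have hrepr : ∀ i l, ContMDiffAt (modelB k).tangent 𝓘(ℝ, ℝ) ∞
      (fun v : TangentBundle (modelB k) (FrameBundle E) =>
        v.proj.basis.repr (localPair E v₀.proj.1.proj i v.proj.1.proj) l) v₀ := fun i l =>
    (contMDiffAt_basis_repr v₀.proj i l).comp v₀ hproj.contMDiffAt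
  have hsm := contMDiffAt_multilinear_expansion (z := fun r => xiV hk j (prodX r))
    (R := fun a => R (B a)) hu1 hrepr
  refine hsm.congr_of_eventuallyEq ?_
  filter_upwards [hu2] with v hv
  have h1 : mfderiv (modelB k) (𝓡 (k + 1)) (fun b : FrameBundle E => b.1.proj) v.proj v.snd
      = polyVector S R v₀.proj.1.proj v.proj.1.proj (B.equivFun.symm
        (u (tangentMap (modelB k) (𝓡 (k + 1)) (fun b : FrameBundle E => b.1.proj) v))) := hv.symm
  change xiV hk j (polyEquiv k v.proj.basis (S.iso v.proj.1.proj
    (mfderiv (modelB k) (𝓡 (k + 1)) (fun b : FrameBundle E => b.1.proj) v.proj v.snd))) = _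
  rw [h1, Module.Basis.equivFun_symm_apply]
  simp only [map_sum, map_smul, polyVector_apply, LinearEquiv.apply_symm_apply, polyEquiv_symProd]
  rfl

end SolderingForm

/-! ### Conformal rotations acting on V[k] -/

section Rotation

open MvPolynomial

/-- The substitution `x ↦ u x + v y`, `y ↦ -v x + u y`. -/
def rotation (u v : ℝ) : MvPolynomial (Fin 2) ℝ →ₐ[ℝ] MvPolynomial (Fin 2) ℝ :=
  aeval ![C u * X 0 + C v * X 1, C (-v) * X 0 + C u * X 1]

theorem eq_of_map_ofReal_add_I_mul {a b a' b' : MvPolynomial (Fin 2) ℝ}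
    (h : map Complex.ofRealHom a + C Complex.I * map Complex.ofRealHom b
      = map Complex.ofRealHom a' + C Complex.I * map Complex.ofRealHom b') : a = a' ∧ b = b' := by
  have h' : ∀ m, coeff m a = coeff m a' ∧ coeff m b = coeff m b' := fun m => by
    have h1 := congrArg (coeff m) h
    simp only [coeff_add, coeff_map, coeff_C_mul, Complex.ofRealHom_eq_coe] at h1
    exact ⟨by simpa using congrArg Complex.re h1, by simpa using congrArg Complex.im h1⟩
  exact ⟨MvPolynomial.ext _ _ fun m => (h' m).1, MvPolynomial.ext _ _ fun m => (h' m).2⟩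

theorem map_ofReal_W (n : ℕ) : map Complex.ofRealHom (Weven n)
    + C Complex.I * map Complex.ofRealHom (Wodd n)
      = (X 0 + C Complex.I * X 1 : MvPolynomial (Fin 2) ℂ) ^ n := by
  have hI : (C Complex.I : MvPolynomial (Fin 2) ℂ) ^ 2 = -1 := by
    rw [← map_pow, Complex.I_sq]; simp
  have h : ∀ P : MvPolynomial (Fin 2) ℝ, map Complex.ofRealHom P
      = aeval ![X 0, X 1] P := fun P => by
    have h1 : (![X 0, X 1] : Fin 2 → MvPolynomial (Fin 2) ℂ) = X := by
      funext i; fin_cases i <;> rfl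
    rw [h1]
    induction P using MvPolynomial.induction_on with
    | C a => simp [MvPolynomial.algebraMap_eq, IsScalarTower.algebraMap_apply ℝ ℂ
        (MvPolynomial (Fin 2) ℂ)]
    | add p q hp hq => rw [map_add, map_add, hp, hq]
    | mul_X p i hp => rw [map_mul, map_mul, hp]; simp
  rw [h, h, aeval_W _ _ _ hI]

/-- The substitution sends x + iy to (u - iv)(x + iy), hence (x + iy)^n to (u - iv)^n (x + iy)^n;
the two formulas are its real and imaginary parts. -/
theorem rotation_W (u v : ℝ) (n : ℕ) :
    rotation u v (Weven n) = C ((⟨u, -v⟩ : ℂ) ^ n).re * Weven n - C ((⟨u, -v⟩ : ℂ) ^ n).im * Wodd n ∧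
    rotation u v (Wodd n)
      = C ((⟨u, -v⟩ : ℂ) ^ n).im * Weven n + C ((⟨u, -v⟩ : ℂ) ^ n).re * Wodd n := by
  apply eq_of_map_ofReal_add_I_mul
  have hI : (C Complex.I : MvPolynomial (Fin 2) ℂ) ^ 2 = -1 := by
    rw [← map_pow, Complex.I_sq]; simp
  set c : ℂ := (⟨u, -v⟩ : ℂ) with hc
  have hcC : ∀ z : ℂ, (C z : MvPolynomial (Fin 2) ℂ)
      = C ((z.re : ℝ) : ℂ) + C Complex.I * C ((z.im : ℝ) : ℂ) := fun z => by
    rw [← map_mul, ← map_add]; congr 1; rw [mul_comm]; exact (Complex.re_add_im z).symm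
  have h1 : map Complex.ofRealHom (rotation u v (Weven n))
      + C Complex.I * map Complex.ofRealHom (rotation u v (Wodd n))
        = (C c * (X 0 + C Complex.I * X 1)) ^ n := by
    have h2 : ∀ P, map Complex.ofRealHom (rotation u v P)
        = aeval (R := ℝ) (![C (u : ℂ) * X 0 + C (v : ℂ) * X 1, C ((-v : ℝ) : ℂ) * X 0 + C (u : ℂ) * X 1] :
          Fin 2 → MvPolynomial (Fin 2) ℂ) P := fun P => by
      induction P using MvPolynomial.induction_on with
      | C a => simp [rotation, MvPolynomial.algebraMap_eq, IsScalarTower.algebraMap_apply ℝ ℂ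
          (MvPolynomial (Fin 2) ℂ)]
      | add p q hp hq => rw [map_add, map_add, hp, hq, map_add]
      | mul_X p i hp =>
        rw [map_mul, map_mul, hp, map_mul]
        congr 1
        fin_cases i <;> simp [rotation]
    rw [h2, h2, aeval_W _ _ _ hI, hcC c, hc]
    congr 1
    simp only [Complex.ofReal_neg, map_neg]
    linear_combination (C (v : ℂ) * X 1) * hI
  rw [h1, mul_pow, ← map_pow, ← map_ofReal_W, hcC (c ^ n)]
  simp only [map_sub, map_add, map_mul, map_C, Complex.ofRealHom_eq_coe]
  linear_combination (C (((c ^ n).im : ℝ) : ℂ) * map Complex.ofRealHom (Wodd n)) * hI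

theorem rotation_sq (u v : ℝ) : rotation u v (X 0 ^ 2 + X 1 ^ 2)
    = C (u ^ 2 + v ^ 2) * (X 0 ^ 2 + X 1 ^ 2) := by
  simp only [rotation, map_add, map_pow, aeval_X, Matrix.cons_val_zero, Matrix.cons_val_one,
    map_neg]
  ring

/-- The factor by which the conformal rotation acts on the form `ξ^{k,j}`. -/
def rotationFactor (k j : ℕ) (u v : ℝ) : ℂ := (u ^ 2 + v ^ 2 : ℝ) ^ j * (⟨u, -v⟩ : ℂ) ^ (k - 2 * j)

/-- The factor x² + y² is scaled by the real number u² + v², so V^even + i V^odd is multiplied by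
`rotationFactor`. -/
theorem rotation_V (k j : ℕ) (u v : ℝ) :
    rotation u v (Veven k j) = (rotationFactor k j u v).re • Veven k j
      - (rotationFactor k j u v).im • Vodd k j ∧
    rotation u v (Vodd k j) = (rotationFactor k j u v).im • Veven k j
      + (rotationFactor k j u v).re • Vodd k j := by
  have hr : (rotationFactor k j u v).re
      = (u ^ 2 + v ^ 2) ^ j * ((⟨u, -v⟩ : ℂ) ^ (k - 2 * j)).re := by
    rw [rotationFactor, ← Complex.ofReal_pow, Complex.re_ofReal_mul]
  have hi : (rotationFactor k j u v).im
      = (u ^ 2 + v ^ 2) ^ j * ((⟨u, -v⟩ : ℂ) ^ (k - 2 * j)).im := by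
    rw [rotationFactor, ← Complex.ofReal_pow, Complex.im_ofReal_mul]
  rw [hr, hi]
  obtain ⟨h1, h2⟩ := rotation_W u v (k - 2 * j)
  simp only [Veven, Vodd, map_mul (rotation u v), map_pow (rotation u v), rotation_sq, h1, h2,
    mul_pow, smul_eq_C_mul, map_mul C, map_pow C]
  constructor <;> ring

theorem rotation_mem {k : ℕ} (u v : ℝ) {P : MvPolynomial (Fin 2) ℝ} (hP : P ∈ V k) :
    rotation u v P ∈ V k := by
  have hl : ∀ a b : ℝ, (C a * X 0 + C b * X 1 : MvPolynomial (Fin 2) ℝ).IsHomogeneous 1 :=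
    fun a b => (isHomogeneous_C_mul_X a 0).add (isHomogeneous_C_mul_X b 1)
  have h := MvPolynomial.IsHomogeneous.aeval (n := 1) (show P.IsHomogeneous k from hP)
    ![C u * X 0 + C v * X 1, C (-v) * X 0 + C u * X 1]
    (Fin.forall_fin_two.2 ⟨hl u v, hl (-v) u⟩)
  rw [one_mul] at h
  exact h

theorem adaptedBasis_inl {k : ℕ} (hk : Odd k) (j : Idx k) :
    (adaptedBasis hk (Sum.inl j) : MvPolynomial (Fin 2) ℝ) = Veven k j := by
  rw [adaptedBasis, coe_basisOfLinearIndependentOfCardEqFinrank]; rfl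

theorem adaptedBasis_inr {k : ℕ} (hk : Odd k) (j : Idx k) :
    (adaptedBasis hk (Sum.inr j) : MvPolynomial (Fin 2) ℝ) = Vodd k j := by
  rw [adaptedBasis, coe_basisOfLinearIndependentOfCardEqFinrank]; rfl

theorem xiV_apply {k : ℕ} (hk : Odd k) (j : Idx k) (P : V k) :
    xiV hk j P = ((adaptedBasis hk).repr P (Sum.inl j) : ℂ)
      + Complex.I * ((adaptedBasis hk).repr P (Sum.inr j) : ℂ) := rfl

/-- A polynomial all of whose complex coordinates vanish is zero. -/
theorem eq_zero_of_xiV {k : ℕ} (hk : Odd k) {P : V k} (h : ∀ j, xiV hk j P = 0) : P = 0 := by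
  apply (adaptedBasis hk).ext_elem
  have h' := fun j => Complex.ext_iff.1 ((xiV_apply hk j P).symm.trans (h j))
  rintro (j | j)
  · simpa using (h' j).1
  · simpa using (h' j).2

/-- Conformal rotations multiply the forms `ξ^{k,j}` by complex factors. -/
theorem xiV_rotation {k : ℕ} (hk : Odd k) (j : Idx k) (u v : ℝ) {P Q : V k}
    (h : (Q : MvPolynomial (Fin 2) ℝ) = rotation u v P) :
    xiV hk j Q = starRingEnd ℂ (rotationFactor k j u v) * xiV hk j P := by
  let ρ : V k →ₗ[ℝ] V k := (rotation u v).toLinearMap.restrict fun _ hP => rotation_mem u v hP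
  have hQ : Q = ρ P := Subtype.ext h
  rw [hQ]
  -- The conjugate appears because a V^even + b V^odd = Re ((a - ib)(V^even + i V^odd)): the
  -- rotation multiplies a - ib by the factor, hence a + ib by its conjugate.
  have hmain : xiV hk j ∘ₗ ρ
      = (LinearMap.mulLeft ℝ (starRingEnd ℂ (rotationFactor k j u v))) ∘ₗ xiV hk j := by
    apply (adaptedBasis hk).ext
    rintro (l | l)
    · have e : ρ (adaptedBasis hk (Sum.inl l))
          = (rotationFactor k l u v).re • adaptedBasis hk (Sum.inl l)
            - (rotationFactor k l u v).im • adaptedBasis hk (Sum.inr l) := by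
        apply Subtype.ext
        change rotation u v (adaptedBasis hk (Sum.inl l) : MvPolynomial (Fin 2) ℝ) = _
        rw [adaptedBasis_inl, (rotation_V k l u v).1]
        simp [adaptedBasis_inl, adaptedBasis_inr]
      rw [LinearMap.comp_apply, e]
      rcases eq_or_ne l j with rfl | hne
      · apply Complex.ext <;> simp [xiV_apply]
      · apply Complex.ext <;> simp [xiV_apply, hne]
    · have e : ρ (adaptedBasis hk (Sum.inr l))
          = (rotationFactor k l u v).im • adaptedBasis hk (Sum.inl l)
            + (rotationFactor k l u v).re • adaptedBasis hk (Sum.inr l) := by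
        apply Subtype.ext
        change rotation u v (adaptedBasis hk (Sum.inr l) : MvPolynomial (Fin 2) ℝ) = _
        rw [adaptedBasis_inr, (rotation_V k l u v).2]
        simp [adaptedBasis_inl, adaptedBasis_inr]
      rw [LinearMap.comp_apply, e]
      rcases eq_or_ne l j with rfl | hne
      · apply Complex.ext <;> simp [xiV_apply]
      · apply Complex.ext <;> simp [xiV_apply, hne]
  exact LinearMap.congr_fun hmain P

end Rotation

/-! ### Equivariance of ξ and ζ under CO(2) -/

section Action

variable {k : ℕ} {M : Type*} [TopologicalSpace M]
  [ChartedSpace (EuclideanSpace ℝ (Fin (k + 1))) M] [IsManifold (𝓡 (k + 1)) ∞ M]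
  {E : M → Type*} [∀ p, AddCommGroup (E p)]
  [∀ p, Module ℝ (E p)] [∀ p, TopologicalSpace (E p)] [TopologicalSpace (TotalSpace F2 E)]
  [FiberBundle F2 E] [VectorBundle ℝ F2 E] [ContMDiffVectorBundle ∞ F2 E (𝓡 (k + 1))]

theorem contMDiff_act (g : GL (Fin 2) ℝ) :
    ContMDiff (modelB k) (modelB k) ∞ (fun b : FrameBundle E => b.act g) := by
  intro b
  rw [← ContMDiffAt.subtypeVal_comp_iff]
  have hb := mem_baseSet_trivializationAt F2 E b.1.proj
  refine ((frameTriv E b.1.proj).contMDiffAt_iff (IM := modelB k) (IB := 𝓡 (k + 1)) (n := ∞)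
    (f := Subtype.val ∘ fun b : FrameBundle E => b.act g) (x₀ := b)
    ((mem_frameTriv_source (b := (b.act g).1)).2 hb)).2 ⟨?_, ?_⟩
  · exact contMDiff_frameBundle_proj.contMDiffAt
  · have h1 : ContDiff ℝ ∞ fun w : F2 × F2 =>
        (g 0 0 • w.1 + g 1 0 • w.2, g 0 1 • w.1 + g 1 1 • w.2) := by fun_prop
    refine (h1.contMDiff.contMDiffAt.comp b (contMDiffAt_frameTriv_snd hb)).congr_of_eventuallyEq ?_
    have hbase : ∀ᶠ c : FrameBundle E in 𝓝 b,
        c.1.proj ∈ (trivializationAt F2 E b.1.proj).baseSet :=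
      (contMDiff_frameBundle_proj (k := k) (E := E)).continuous.continuousAt.eventually_mem
        ((trivializationAt F2 E b.1.proj).open_baseSet.mem_nhds hb)
    filter_upwards [hbase] with c hc
    exact frameTriv_act hc g

theorem mdifferentiable_act (g : GL (Fin 2) ℝ) :
    MDifferentiable (modelB k) (modelB k) (fun b : FrameBundle E => b.act g) :=
  (contMDiff_act g).mdifferentiable (by simp)

theorem mdifferentiable_frameBundle_proj :
    MDifferentiable (modelB k) (𝓡 (k + 1)) (fun b : FrameBundle E => b.1.proj) :=
  contMDiff_frameBundle_proj.mdifferentiable (by simp)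

theorem surjective_mfderiv_act (g : GL (Fin 2) ℝ) (b : FrameBundle E) :
    Function.Surjective (mfderiv (modelB k) (modelB k) (fun c : FrameBundle E => c.act g) b) := by
  have h1 := mfderiv_comp (b.act g) (mdifferentiable_act (k := k) g ((b.act g).act g⁻¹))
    (mdifferentiable_act (k := k) g⁻¹ (b.act g))
  have h2 : (fun c : FrameBundle E => c.act g) ∘ (fun c : FrameBundle E => c.act g⁻¹) = id := by
    funext c
    change (c.act g⁻¹).act g = c
    rw [← FrameBundle.act_mul, inv_mul_cancel, FrameBundle.act_one]
  have h3 : Function.Surjective (mfderiv (modelB k) (modelB k)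
      ((fun c : FrameBundle E => c.act g) ∘ (fun c : FrameBundle E => c.act g⁻¹)) (b.act g)) := by
    rw [h2, mfderiv_id]
    exact Function.surjective_id
  rw [h1] at h3
  have h4 : Function.Surjective (mfderiv (modelB k) (modelB k) (fun c : FrameBundle E => c.act g)
      ((b.act g).act g⁻¹)) := Function.Surjective.of_comp h3
  have h5 : (b.act g).act g⁻¹ = b := by
    rw [← FrameBundle.act_mul, mul_inv_cancel, FrameBundle.act_one]
  rwa [h5] at h4

/-- Composed with a slope section through b, the projection becomes a linear projection followed by
an inverse chart, whose differential is onto. -/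
theorem surjective_mfderiv_frameBundle_proj (b : FrameBundle E) :
    Function.Surjective
      (mfderiv (modelB k) (𝓡 (k + 1)) (fun c : FrameBundle E => c.1.proj) b) := by
  have hb : b ∈ slopeDomain E k b.1.proj := mem_slopeDomain_self b
  have ht := slopeCoord_mem_slopeTarget hb
  have hc := complexCoord_one_ne_zero ((mem_frameOpens_iff_slope hb.2).1 b.2)
  have hsec := slopeSection_slopeCoord hb b
  set t := slopeCoord E k b.1.proj b
  set c := complexCoord (frameTriv E b.1.proj b.1).2 1
  have h1 := mfderiv_comp t (mdifferentiable_frameBundle_proj (k := k)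
    (slopeSection E k b.1.proj c b t))
    ((contMDiffAt_slopeSection ht hc b).mdifferentiableAt (by simp))
  let pr : EuclideanSpace ℝ (Fin (k + 3)) →L[ℝ] EuclideanSpace ℝ (Fin (k + 1)) :=
    (ContinuousLinearMap.fst ℝ _ ℂ).comp (coordsEquiv k : _ →L[ℝ] _)
  have hpr : Function.Surjective pr := Prod.fst_surjective.comp (coordsEquiv k).surjective
  have hchart := IsManifold.chart_mem_maximalAtlas (I := 𝓡 (k + 1)) (n := ∞) b.1.proj
  have h2 : (fun c : FrameBundle E => c.1.proj) ∘ slopeSection E k b.1.proj c b =ᶠ[𝓝 t]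
      (chartAt (EuclideanSpace ℝ (Fin (k + 1))) b.1.proj).symm ∘ pr := by
    filter_upwards [isOpen_slopeTarget.mem_nhds ht] with s hs
    change (slopeSection E k b.1.proj c b s).1.proj = _
    rw [slopeSection_val hs hc, slopePoint_proj hs]
    rfl
  have h3 := mfderiv_comp (I := 𝓡 (k + 3)) (I' := 𝓡 (k + 1)) (I'' := 𝓡 (k + 1)) t
    ((contMDiffAt_symm_of_mem_maximalAtlas hchart ht.1.1).mdifferentiableAt (by simp))
    pr.mdifferentiableAt
  have h4 : Function.Surjective (mfderiv (𝓡 (k + 3)) (𝓡 (k + 1))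
      ((fun c : FrameBundle E => c.1.proj) ∘ slopeSection E k b.1.proj c b) t) := by
    rw [h2.mfderiv_eq, h3, pr.mfderiv_eq]
    exact (surjective_mfderiv_symm_of_mem_maximalAtlas hchart ht.1.1).comp hpr
  rw [h1] at h4
  have h5 : Function.Surjective (mfderiv (modelB k) (𝓡 (k + 1))
      (fun c : FrameBundle E => c.1.proj) (slopeSection E k b.1.proj c b t)) :=
    Function.Surjective.of_comp h4
  rwa [hsec] at h5

theorem mfderiv_proj_act (g : GL (Fin 2) ℝ) (b : FrameBundle E) (v : TangentSpace (modelB k) b) :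
    mfderiv (modelB k) (𝓡 (k + 1)) (fun c : FrameBundle E => c.1.proj) (b.act g)
      (mfderiv (modelB k) (modelB k) (fun c : FrameBundle E => c.act g) b v)
      = mfderiv (modelB k) (𝓡 (k + 1)) (fun c : FrameBundle E => c.1.proj) b v := by
  have h := mfderiv_comp b (mdifferentiable_frameBundle_proj (k := k) (b.act g))
    (mdifferentiable_act (k := k) g b)
  exact (DFunLike.congr_fun h v).symm

/-- Change of frame acts on polynomial coordinates by substitution. -/
theorem polyEquiv_act {b : FrameBundle E} {g : GL (Fin 2) ℝ} {u v : ℝ}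
    (hg : (g : Matrix (Fin 2) (Fin 2) ℝ) = !![u, -v; v, u]) (s : SymPow k (E b.1.proj)) :
    (polyEquiv k b.basis s : MvPolynomial (Fin 2) ℝ)
      = rotation u v (polyEquiv k (b.act g).basis s : MvPolynomial (Fin 2) ℝ) := by
  have h : (SymmetricAlgebra.equivMvPolynomial b.basis).toAlgHom
      = (rotation u v).comp (SymmetricAlgebra.equivMvPolynomial (b.act g).basis).toAlgHom := by
    -- Algebra maps out of the symmetric algebra are compared on the vectors of the new frame, u x +
    -- v y and -v x + u y, which is exactly the substitution `rotation u v`.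
    apply SymmetricAlgebra.algHom_ext
    apply (b.act g).basis.ext
    have e : ∀ w : E b.1.proj, SymmetricAlgebra.equivMvPolynomial b.basis
        (SymmetricAlgebra.ι ℝ _ w) = ∑ j, MvPolynomial.C (b.basis.repr w j) * MvPolynomial.X j :=
      equivMvPolynomial_ι b.basis
    have e0 : (b.act g).basis 0 = u • b.basis 0 + v • b.basis 1 := by
      simp only [FrameBundle.coe_basis, Matrix.cons_val_zero, Matrix.cons_val_one]
      simp [FrameBundle.act, FrameBundle.fst, FrameBundle.snd, hg]
    have e1 : (b.act g).basis 1 = (-v) • b.basis 0 + u • b.basis 1 := by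
      simp only [FrameBundle.coe_basis, Matrix.cons_val_zero, Matrix.cons_val_one]
      simp [FrameBundle.act, FrameBundle.fst, FrameBundle.snd, hg]
    intro i
    have hR : (rotation u v) (SymmetricAlgebra.equivMvPolynomial (b.act g).basis
        (SymmetricAlgebra.ι ℝ _ ((b.act g).basis i))) = rotation u v (MvPolynomial.X i) := by
      rw [SymmetricAlgebra.equivMvPolynomial_ι_apply]
    refine Eq.trans ?_ hR.symm
    refine (e _).trans ?_
    fin_cases i
    · change ∑ j, MvPolynomial.C (b.basis.repr ((b.act g).basis 0) j) * MvPolynomial.X j = _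
      rw [e0]
      simp [rotation, Fin.sum_univ_two, Finsupp.single_apply]
    · change ∑ j, MvPolynomial.C (b.basis.repr ((b.act g).basis 1) j) * MvPolynomial.X j = _
      rw [e1]
      simp [rotation, Fin.sum_univ_two, Finsupp.single_apply]
  exact DFunLike.congr_fun h (s : SymmetricAlgebra ℝ (E b.1.proj))

/-- Translation by g leaves the projection to M unchanged, so only the frame in which the polynomial
is written changes, and this is a conformal rotation. -/
theorem xi_act (S : GL2Structure k M E) (hk : Odd k) (j : Idx k) {b : FrameBundle E}
    {g : GL (Fin 2) ℝ} {u v : ℝ} (hg : (g : Matrix (Fin 2) (Fin 2) ℝ) = !![u, -v; v, u])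
    (w : TangentSpace (modelB k) b) :
    xi S hk j b w = starRingEnd ℂ (rotationFactor k j u v) * xi S hk j (b.act g)
      (mfderiv (modelB k) (modelB k) (fun c : FrameBundle E => c.act g) b w) := by
  refine xiV_rotation hk j u v ?_
  refine (polyEquiv_act hg _).trans ?_
  refine congrArg (fun s => rotation u v (polyEquiv k (b.act g).basis s : V k)) ?_
  exact congrArg (S.iso b.1.proj) (mfderiv_proj_act g b w).symm

/-- ζ encodes the trace-free symmetric part of φ, a complement of co(2) in gl(2). Conjugation by g
preserves this plane and turns it by a complex number of modulus 1; the relation g φ' = φ g, with φ'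
the value on the translated vector, gives it without inverting g. -/
theorem zeta_act
    {φ : ∀ b : FrameBundle E, TangentSpace (modelB k) b →ₗ[ℝ] Matrix (Fin 2) (Fin 2) ℝ}
    (hφ : IsGL2Connection k φ) {b : FrameBundle E}
    {g : GL (Fin 2) ℝ} {u v : ℝ} (hg : (g : Matrix (Fin 2) (Fin 2) ℝ) = !![u, -v; v, u])
    (w : TangentSpace (modelB k) b) :
    zeta φ b w = (⟨u, v⟩ ^ 2 / (u ^ 2 + v ^ 2 : ℝ) : ℂ) * zeta φ (b.act g)
      (mfderiv (modelB k) (modelB k) (fun c : FrameBundle E => c.act g) b w) := by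
  have hdet := g.det.ne_zero
  rw [Matrix.GeneralLinearGroup.val_det_apply, hg, Matrix.det_fin_two_of] at hdet
  have hD : u ^ 2 + v ^ 2 ≠ 0 := by
    intro h; apply hdet; linear_combination h
  have h1 : g.val * φ (b.act g) (mfderiv (modelB k) (modelB k)
      (fun c : FrameBundle E => c.act g) b w) = φ b w * g.val := by
    rw [hφ.equivariant g b w, ← mul_assoc, ← mul_assoc, Units.mul_inv, one_mul]
  change ((φ b w 1 0 + φ b w 0 1 : ℝ) : ℂ) + Complex.I * ((φ b w 1 1 - φ b w 0 0 : ℝ) : ℂ)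
    = _ * (((_ : ℝ) : ℂ) + Complex.I * ((_ : ℝ) : ℂ))
  set A := φ (b.act g) (mfderiv (modelB k) (modelB k) (fun c : FrameBundle E => c.act g) b w)
  set B := φ b w
  rw [hg] at h1
  have e : ∀ i j, (!![u, -v; v, u] * A) i j = (B * !![u, -v; v, u]) i j := fun i j => by rw [h1]
  have e00 := e 0 0
  have e01 := e 0 1
  have e10 := e 1 0
  have e11 := e 1 1
  simp [Matrix.mul_apply, Fin.sum_univ_two] at e00 e01 e10 e11
  rw [div_mul_eq_mul_div, eq_div_iff (by exact_mod_cast hD)]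
  apply Complex.ext
  · simp [pow_two]
    linear_combination (-u) * e10 + (-u) * e01 + (-v) * e00 + v * e11
  · simp [pow_two]
    linear_combination (-u) * e11 + u * e00 + (-v) * e10 + (-v) * e01

end Action

/-! ### Descent of a complex structure along a submersion -/

section DescendedStructure

variable {V₁ H₁ : Type*} [NormedAddCommGroup V₁] [NormedSpace ℝ V₁]
  [TopologicalSpace H₁] {I₁ : ModelWithCorners ℝ V₁ H₁} {N₁ N₂ : Type*}
  [TopologicalSpace N₁] [ChartedSpace H₁ N₁] [TopologicalSpace N₂] {d : ℕ}
  [ChartedSpace (EuclideanSpace ℝ (Fin d)) N₂]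
  {G : Type*} [NormedAddCommGroup G] [NormedSpace ℂ G]

variable (I₁ d) in
/-- `q` is a submersion and the forms `F` with complex values define a complex structure on its
normal spaces, which is constant along the fibres of `q`. -/
structure IsTransverseCoframe (q : N₁ → N₂) (F : ∀ b : N₁, TangentSpace I₁ b →ₗ[ℝ] G) :
    Prop where
  surjective : Function.Surjective q
  submersion : IsSmoothSubmersion I₁ (𝓡 d) q
  ker : ∀ (b : N₁) (v : TangentSpace I₁ b), mfderiv I₁ (𝓡 d) q b v = 0 ↔ F b v = 0
  coframe_surjective : ∀ b, Function.Surjective (F b)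
  transport : ∀ b b', q b = q b' → ∃ R : N₁ → N₁, R b = b' ∧ q ∘ R = q ∧
    MDifferentiableAt I₁ I₁ R b ∧ Function.Surjective (mfderiv I₁ I₁ R b) ∧
    ∀ v v' : TangentSpace I₁ b,
      F (R b) (mfderiv I₁ I₁ R b v') = Complex.I • F (R b) (mfderiv I₁ I₁ R b v) →
      F b v' = Complex.I • F b v

/-- The endomorphism `J` of the tangent space at `q b` corresponds to multiplication by `i`. -/
def IsPushforwardAt (q : N₁ → N₂) (F : ∀ b : N₁, TangentSpace I₁ b →ₗ[ℝ] G) (b : N₁)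
    (J : TangentSpace (𝓡 d) (q b) →ₗ[ℝ] TangentSpace (𝓡 d) (q b)) : Prop :=
  ∀ v v' : TangentSpace I₁ b, F b v' = Complex.I • F b v →
    J (mfderiv I₁ (𝓡 d) q b v) = mfderiv I₁ (𝓡 d) q b v'

/-- Transport of endomorphisms of tangent spaces along an equality of points. -/
def castEnd {z z' : N₂} (h : z = z') (J : TangentSpace (𝓡 d) z →ₗ[ℝ] TangentSpace (𝓡 d) z) :
    TangentSpace (𝓡 d) z' →ₗ[ℝ] TangentSpace (𝓡 d) z' :=
  Eq.rec (motive := fun z' _ => TangentSpace (𝓡 d) z' →ₗ[ℝ] TangentSpace (𝓡 d) z') J h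

namespace IsTransverseCoframe

variable {q : N₁ → N₂} {F : ∀ b : N₁, TangentSpace I₁ b →ₗ[ℝ] G}

theorem mfderiv_eq_iff (h : IsTransverseCoframe I₁ d q F) {b : N₁} {v v' : TangentSpace I₁ b} :
    mfderiv I₁ (𝓡 d) q b v = mfderiv I₁ (𝓡 d) q b v' ↔ F b v = F b v' := by
  rw [← sub_eq_zero, ← map_sub, h.ker, map_sub, sub_eq_zero]

/-- dq and F are onto with the same kernel, so multiplication by i carries over to the tangent space
at q b. The linear right inverses s and t are arbitrary: their ambiguity lies in that kernel. -/
theorem exists_isPushforwardAt (h : IsTransverseCoframe I₁ d q F) (b : N₁) :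
    ∃ J, IsPushforwardAt (d := d) q F b J := by
  obtain ⟨s, hs⟩ := (mfderiv I₁ (𝓡 d) q b).toLinearMap.exists_rightInverse_of_surjective
    (LinearMap.range_eq_top.2 (h.submersion.surjective_mfderiv b))
  obtain ⟨t, ht⟩ := (F b).exists_rightInverse_of_surjective
    (LinearMap.range_eq_top.2 (h.coframe_surjective b))
  refine ⟨(mfderiv I₁ (𝓡 d) q b).toLinearMap ∘ₗ t ∘ₗ (LinearMap.lsmul ℂ G Complex.I).restrictScalars ℝ
    ∘ₗ F b ∘ₗ s, fun v v' hv => ?_⟩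
  refine h.mfderiv_eq_iff.2 ?_
  have h1 : F b (s (mfderiv I₁ (𝓡 d) q b v)) = F b v :=
    h.mfderiv_eq_iff.1 (LinearMap.congr_fun hs (mfderiv I₁ (𝓡 d) q b v))
  have h2 := LinearMap.congr_fun ht (Complex.I • F b (s (mfderiv I₁ (𝓡 d) q b v)))
  rw [h1] at h2
  refine Eq.trans ?_ (h2.trans hv.symm)
  change F b (t (Complex.I • F b (s (mfderiv I₁ (𝓡 d) q b v)))) = _
  rw [h1]
  rfl

/-- The transport map R preserves q, and its differential reflects the relation F v' = i F v. This
suffices for the endomorphism built at b to serve at b', even though F is not R-invariant. -/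
theorem isPushforwardAt_castEnd (h : IsTransverseCoframe I₁ d q F) {b b' : N₁} (hb : q b = q b')
    {J : TangentSpace (𝓡 d) (q b) →ₗ[ℝ] TangentSpace (𝓡 d) (q b)}
    (hJ : IsPushforwardAt q F b J) : IsPushforwardAt q F b' (castEnd hb J) := by
  obtain ⟨R, rfl, hqR, hR, hRs, hF⟩ := h.transport b b' hb
  intro v v' hv
  obtain ⟨w, rfl⟩ := hRs v
  obtain ⟨w', rfl⟩ := hRs v'
  have hw := hF w w' hv
  have hcomp := mfderiv_comp b ((h.submersion.contMDiff (R b)).mdifferentiableAt (by simp)) hR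
  have e : ∀ w, mfderiv I₁ (𝓡 d) q (R b) (mfderiv I₁ I₁ R b w) = mfderiv I₁ (𝓡 d) (q ∘ R) b w :=
    fun w => (DFunLike.congr_fun hcomp w).symm
  rw [e, e]
  -- The map is generalized to an arbitrary f equal to q because the tangent spaces depend on its
  -- values.
  have key : ∀ (f : N₁ → N₂) (_ : f = q) (hfb : q b = f b),
      castEnd hfb J (mfderiv I₁ (𝓡 d) f b w) = mfderiv I₁ (𝓡 d) f b w' := by
    rintro f rfl hfb
    exact hJ w w' hw
  exact key (q ∘ R) hqR hb

theorem exists_isPushforward (h : IsTransverseCoframe I₁ d q F) :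
    ∃ J : ∀ z : N₂, TangentSpace (𝓡 d) z →ₗ[ℝ] TangentSpace (𝓡 d) z,
      ∀ b, IsPushforwardAt q F b (J (q b)) := by
  choose J₀ hJ₀ using h.exists_isPushforwardAt
  choose s hs using h.surjective
  exact ⟨fun z => castEnd (hs z) (J₀ (s z)), fun b =>
    h.isPushforwardAt_castEnd (hs (q b)) (hJ₀ (s (q b)))⟩

variable {J : ∀ z : N₂, TangentSpace (𝓡 d) z →ₗ[ℝ] TangentSpace (𝓡 d) z}

theorem sq_eq_neg (h : IsTransverseCoframe I₁ d q F) (hJ : ∀ b, IsPushforwardAt q F b (J (q b)))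
    (z : N₂) (x : TangentSpace (𝓡 d) z) : J z (J z x) = -x := by
  obtain ⟨b, rfl⟩ := h.surjective z
  obtain ⟨v, rfl⟩ := h.submersion.surjective_mfderiv b x
  obtain ⟨v', hv'⟩ := h.coframe_surjective b (Complex.I • F b v)
  rw [hJ b v v' hv', hJ b v' (-v), map_neg]
  rw [hv', smul_smul, Complex.I_mul_I, neg_one_smul, map_neg]

/-- The `(1,0)`-forms pull back to the complex combinations of the coframe. -/
theorem isOneZero_iff (h : IsTransverseCoframe I₁ d q F) (hJ : ∀ b, IsPushforwardAt q F b (J (q b)))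
    (b : N₁) (β : TangentSpace I₁ b →ₗ[ℝ] ℂ) :
    (∃ α : TangentSpace (𝓡 d) (q b) →ₗ[ℝ] ℂ, IsOneZero J (q b) α ∧
      β = α ∘ₗ (mfderiv I₁ (𝓡 d) q b).toLinearMap) ↔
    ∃ l : G →ₗ[ℂ] ℂ, β = l.restrictScalars ℝ ∘ₗ F b := by
  constructor
  · rintro ⟨α, hα, rfl⟩
    obtain ⟨t, ht⟩ := (F b).exists_rightInverse_of_surjective
      (LinearMap.range_eq_top.2 (h.coframe_surjective b))
    have ht' : ∀ g, F b (t g) = g := fun g => LinearMap.congr_fun ht g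
    let l₀ : G →ₗ[ℝ] ℂ := (α ∘ₗ (mfderiv I₁ (𝓡 d) q b).toLinearMap) ∘ₗ t
    -- A real-linear map commuting with multiplication by i is complex-linear; here this is the
    -- (1,0) condition on α.
    have hI : ∀ g, l₀ (Complex.I • g) = Complex.I * l₀ g := fun g => by
      have h1 := hJ b (t g) (t (Complex.I • g)) (by rw [ht', ht'])
      change α (mfderiv I₁ (𝓡 d) q b (t (Complex.I • g))) = _
      rw [← h1]
      exact hα _
    refine ⟨{ toFun := l₀
              map_add' := map_add l₀
              map_smul' := fun c g => ?_ }, ?_⟩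
    · have e : c • g = c.re • g + c.im • (Complex.I • g) := by
        conv_lhs => rw [← Complex.re_add_im c, add_smul, mul_smul]
        rfl
      rw [e, map_add, map_smul, map_smul, hI, Complex.real_smul, Complex.real_smul, smul_eq_mul]
      conv_rhs => rw [RingHom.id_apply, ← Complex.re_add_im c]
      ring
    · ext v
      change α (mfderiv I₁ (𝓡 d) q b v) = α (mfderiv I₁ (𝓡 d) q b (t (F b v)))
      rw [h.mfderiv_eq_iff.2 (ht' (F b v))]
  · rintro ⟨l, rfl⟩
    obtain ⟨s, hs⟩ := (mfderiv I₁ (𝓡 d) q b).toLinearMap.exists_rightInverse_of_surjective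
      (LinearMap.range_eq_top.2 (h.submersion.surjective_mfderiv b))
    have hFs : ∀ v, F b (s (mfderiv I₁ (𝓡 d) q b v)) = F b v := fun v =>
      h.mfderiv_eq_iff.1 (LinearMap.congr_fun hs (mfderiv I₁ (𝓡 d) q b v))
    refine ⟨l.restrictScalars ℝ ∘ₗ F b ∘ₗ s, fun x => ?_, ?_⟩
    · obtain ⟨v, rfl⟩ := h.submersion.surjective_mfderiv b x
      obtain ⟨v', hv'⟩ := h.coframe_surjective b (Complex.I • F b v)
      rw [hJ b v v' hv']
      change l (F b (s (mfderiv I₁ (𝓡 d) q b v'))) = _ * l (F b (s (mfderiv I₁ (𝓡 d) q b v)))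
      rw [hFs, hFs, hv', map_smul, smul_eq_mul]
    · ext v
      change l (F b v) = l (F b (s (mfderiv I₁ (𝓡 d) q b v)))
      rw [hFs]

/-- If l ∘ F is the pullback of a (1,0)-form and dq v'' = J(dq v), then l(F v'') = i l(F v). As
complex functionals l separate points, F v'' = i F v. -/
theorem isPushforwardAt_of_isOneZero_iff (h : IsTransverseCoframe I₁ d q F) {b : N₁}
    (hJ : ∀ β : TangentSpace I₁ b →ₗ[ℝ] ℂ,
      (∃ l : G →ₗ[ℂ] ℂ, β = l.restrictScalars ℝ ∘ₗ F b) →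
      ∃ α : TangentSpace (𝓡 d) (q b) →ₗ[ℝ] ℂ, IsOneZero J (q b) α ∧
        β = α ∘ₗ (mfderiv I₁ (𝓡 d) q b).toLinearMap) : IsPushforwardAt q F b (J (q b)) := by
  intro v v' hv
  obtain ⟨v'', hv''⟩ := h.submersion.surjective_mfderiv b (J (q b) (mfderiv I₁ (𝓡 d) q b v))
  rw [← hv'']
  refine h.mfderiv_eq_iff.2 ?_
  rw [hv, ← sub_eq_zero, ← Module.forall_dual_apply_eq_zero_iff ℂ]
  intro l
  obtain ⟨α, hα, hl⟩ := hJ _ ⟨l, rfl⟩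
  have e : ∀ w, l (F b w) = α (mfderiv I₁ (𝓡 d) q b w) := fun w => LinearMap.congr_fun hl w
  rw [map_sub, map_smul, e, e, hv'', hα, smul_eq_mul, sub_self]

theorem isPushforward_unique (h : IsTransverseCoframe I₁ d q F)
    {J' : ∀ z : N₂, TangentSpace (𝓡 d) z →ₗ[ℝ] TangentSpace (𝓡 d) z}
    (hJ : ∀ b, IsPushforwardAt q F b (J (q b))) (hJ' : ∀ b, IsPushforwardAt q F b (J' (q b))) :
    J = J' := by
  funext z
  obtain ⟨b, rfl⟩ := h.surjective z
  ext1 x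
  obtain ⟨v, rfl⟩ := h.submersion.surjective_mfderiv b x
  obtain ⟨v', hv'⟩ := h.coframe_surjective b (Complex.I • F b v)
  rw [hJ b v v' hv', hJ' b v v' hv']

variable [FiniteDimensional ℝ G] [I₁.Boundaryless] [IsManifold I₁ ∞ N₁]
  [IsManifold (𝓡 d) ∞ N₂]

theorem contMDiff_pushforward (h : IsTransverseCoframe I₁ d q F)
    (hd : Module.finrank ℝ G = d)
    (hF : ContMDiff I₁.tangent 𝓘(ℝ, G) ∞ (fun v : TangentBundle I₁ N₁ => F v.proj v.snd))
    (hJ : ∀ b, IsPushforwardAt q F b (J (q b))) :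
    ContMDiff (𝓡 d).tangent (𝓡 d).tangent ∞
      (fun v : TangentBundle (𝓡 d) N₂ => (⟨v.proj, J v.proj v.snd⟩ : TangentBundle (𝓡 d) N₂)) := by
  haveI : IsManifold I₁ 1 N₁ := IsManifold.of_le (n := ∞) (by simp)
  haveI : IsManifold (𝓡 d) 1 N₂ := IsManifold.of_le (n := ∞) (by simp)
  intro w₀
  obtain ⟨b₀, hb₀⟩ := h.surjective w₀.proj
  obtain ⟨σ, hσ, -, hqσ⟩ := h.submersion.exists_localSection b₀
  rw [hb₀] at hσ hqσ
  set e := trivializationAt (EuclideanSpace ℝ (Fin d)) (TangentSpace (𝓡 d)) w₀.proj with he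
  have hproj : ContMDiff (𝓡 d).tangent (𝓡 d) ∞ (fun v : TangentBundle (𝓡 d) N₂ => v.proj) :=
    contMDiff_proj (TangentSpace (𝓡 d))
  have hmem : w₀.proj ∈ e.baseSet := mem_baseSet_trivializationAt _ _ w₀.proj
  have hbase : ∀ᶠ w : TangentBundle (𝓡 d) N₂ in 𝓝 w₀, w.proj ∈ e.baseSet :=
    hproj.continuous.continuousAt.eventually_mem (e.open_baseSet.mem_nhds hmem)
  have hsec : ∀ᶠ w : TangentBundle (𝓡 d) N₂ in 𝓝 w₀, ∀ᶠ z in 𝓝 w.proj, q (σ z) = z :=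
    hproj.continuous.continuousAt.eventually hqσ.eventually_nhds
  have hdiff : ∀ᶠ w : TangentBundle (𝓡 d) N₂ in 𝓝 w₀, MDifferentiableAt (𝓡 d) I₁ σ w.proj :=
    hproj.continuous.continuousAt.eventually
      (((contMDiffAt_iff_contMDiffAt_nhds (by simp)).1
        (hσ.of_le (by simp : (1 : WithTop ℕ∞) ≤ ∞))).mono
        fun z hz => hz.mdifferentiableAt (by simp))
  have hid : ∀ z : N₂, (∀ᶠ z' in 𝓝 z, q (σ z') = z') → MDifferentiableAt (𝓡 d) I₁ σ z →
      ∀ x : TangentSpace (𝓡 d) z,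
        mfderiv I₁ (𝓡 d) q (σ z) (mfderiv (𝓡 d) I₁ σ z x) = (x : EuclideanSpace ℝ (Fin d)) := by
    intro z h1 h2 x
    have h3 := mfderiv_comp z ((h.submersion.contMDiff (σ z)).mdifferentiableAt (by simp)) h2
    have h4 : q ∘ σ =ᶠ[𝓝 z] id := h1
    have h5 : mfderiv (𝓡 d) (𝓡 d) (q ∘ σ) z x = (x : EuclideanSpace ℝ (Fin d)) := by
      rw [h4.mfderiv_eq, mfderiv_id]
      rfl
    exact (DFunLike.congr_fun h3 x).symm.trans h5
  have hJ' : ∀ b z (_ : q b = z) (v v' : TangentSpace I₁ b), F b v' = Complex.I • F b v →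
      J z (mfderiv I₁ (𝓡 d) q b v) = mfderiv I₁ (𝓡 d) q b v' := by
    rintro b _ rfl v v' hv
    exact hJ b v v' hv
  rw [contMDiffAt_totalSpace]
  refine ⟨hproj.contMDiffAt, ?_⟩
  -- J w is characterized by F(dσ(J w)) = i F(dσ w), solved here for the coordinates of J w in a
  -- trivialization of the tangent bundle.
  refine contMDiffAt_of_linear_eq
    (A := fun w : TangentBundle (𝓡 d) N₂ => F (σ w.proj) ∘ₗ
      (mfderiv (𝓡 d) I₁ σ w.proj).toLinearMap ∘ₗ (e.symmL ℝ w.proj).toLinearMap)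
    (y := fun w : TangentBundle (𝓡 d) N₂ =>
      Complex.I • F (σ w.proj) (mfderiv (𝓡 d) I₁ σ w.proj w.snd)) ?_ ?_ ?_ ?_
  · intro c
    have h1 : ContMDiffAt (𝓡 d).tangent (𝓡 d).tangent ∞
        (fun w : TangentBundle (𝓡 d) N₂ => e.toOpenPartialHomeomorph.symm (w.proj, c)) w₀ :=
      ((e.contMDiffOn_symm (n := ∞) (IB := 𝓡 d)).contMDiffAt
        (e.open_target.mem_nhds (e.mem_target.2 (hmem : ((w₀.proj, c)).1 ∈ _)))).comp w₀
          (hproj.contMDiffAt.prodMk contMDiffAt_const)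
    have h2 : (e.toOpenPartialHomeomorph.symm (w₀.proj, c)).proj = w₀.proj :=
      e.proj_symm_apply' hmem
    have h3 := (contMDiffAt_tangentMap (by rw [h2]; exact hσ)).comp w₀ h1
    refine (hF.contMDiffAt.comp w₀ h3).congr_of_eventuallyEq ?_
    filter_upwards [hbase] with w hw
    have h4 : F (σ w.proj) (mfderiv (𝓡 d) I₁ σ w.proj (e.symm w.proj c))
        = F (σ (e.toOpenPartialHomeomorph.symm (w.proj, c)).proj)
          (mfderiv (𝓡 d) I₁ σ (e.toOpenPartialHomeomorph.symm (w.proj, c)).proj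
            (e.toOpenPartialHomeomorph.symm (w.proj, c)).snd) := by
      rw [← e.mk_symm hw]
    refine Eq.trans ?_ h4
    change F (σ w.proj) (mfderiv (𝓡 d) I₁ σ w.proj (e.symmL ℝ w.proj c)) = _
    rw [e.symmL_apply hw]
  · filter_upwards [hbase, hsec, hdiff] with w h1 h2 h3
    -- If F kills dσ x then so does dq, while dq(dσ x) = x; equality of dimensions turns injectivity
    -- into bijectivity.
    have hinj : Function.Injective (F (σ w.proj) ∘ₗ
        (mfderiv (𝓡 d) I₁ σ w.proj).toLinearMap ∘ₗ (e.symmL ℝ w.proj).toLinearMap) := by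
      refine (injective_iff_map_eq_zero _).2 fun c hc => ?_
      have h4 : mfderiv I₁ (𝓡 d) q (σ w.proj)
          (mfderiv (𝓡 d) I₁ σ w.proj (e.symmL ℝ w.proj c)) = 0 := (h.ker _ _).2 hc
      have h5 : e.symmL ℝ w.proj c = 0 := (hid w.proj h2 h3 _).symm.trans h4
      rw [← e.continuousLinearMapAt_symmL (R := ℝ) h1 c, h5, map_zero]
    exact ⟨hinj, (LinearMap.injective_iff_surjective_of_finrank_eq_finrank
      (by rw [hd, finrank_euclideanSpace_fin])).1 hinj⟩
  · have h1 : ContMDiffAt (𝓡 d).tangent 𝓘(ℝ, G) ∞ (fun w : TangentBundle (𝓡 d) N₂ =>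
        F (σ w.proj) (mfderiv (𝓡 d) I₁ σ w.proj w.snd)) w₀ :=
      hF.contMDiffAt.comp w₀ (contMDiffAt_tangentMap hσ)
    exact (((LinearMap.lsmul ℂ G Complex.I).restrictScalars ℝ).toContinuousLinearMap
      ).contDiff.contMDiff.contMDiffAt.comp w₀ h1
  · filter_upwards [hbase, hsec, hdiff] with w h1 h2 h3
    have hz := h2.self_of_nhds
    obtain ⟨v', hv'⟩ := h.coframe_surjective (σ w.proj)
      (Complex.I • F (σ w.proj) (mfderiv (𝓡 d) I₁ σ w.proj w.snd))
    have h4 : J w.proj w.snd = mfderiv I₁ (𝓡 d) q (σ w.proj) v' :=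
      (congrArg (J w.proj) (hid w.proj h2 h3 w.snd).symm).trans
        (hJ' (σ w.proj) w.proj hz _ v' hv')
    have h5 : F (σ w.proj) (mfderiv (𝓡 d) I₁ σ w.proj (J w.proj w.snd)) = F (σ w.proj) v' :=
      h.mfderiv_eq_iff.1 ((hid w.proj h2 h3 (J w.proj w.snd)).trans h4)
    change F (σ w.proj) (mfderiv (𝓡 d) I₁ σ w.proj
      (e.symmL ℝ w.proj (e ⟨w.proj, J w.proj w.snd⟩).2)) = _
    rw [← e.continuousLinearMapAt_apply_of_mem (R := ℝ) h1, e.symmL_continuousLinearMapAt h1]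
    exact h5.trans hv'

end IsTransverseCoframe

end DescendedStructure

/-! ### Linear algebra of the coframe and of co(2) -/

section LinearAlgebra

/-- The kernel of p has dimension 4, so φ is an isomorphism from it onto gl(2). A vector of ker F is
vertical with φ-value in co(2), hence equals the vector supplied by `hv`, which q kills. Thus ker F
≤ ker q; the latter has dimension 2 and the former at least 2, so they agree and F is onto. -/
theorem ker_iff_and_surjective_of_vertical {T X Y G : Type*} [AddCommGroup T] [Module ℝ T]
    [AddCommGroup X] [Module ℝ X] [AddCommGroup Y] [Module ℝ Y] [AddCommGroup G] [Module ℝ G]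
    {k : ℕ} (hT : Module.finrank ℝ T = k + 5)
    (hX : Module.finrank ℝ X = k + 1) (hY : Module.finrank ℝ Y = k + 3)
    (hG : Module.finrank ℝ G = k + 3) {p : T →ₗ[ℝ] X} {q : T →ₗ[ℝ] Y}
    {φ : T →ₗ[ℝ] Matrix (Fin 2) (Fin 2) ℝ} {F : T →ₗ[ℝ] G} (hp : Function.Surjective p)
    (hq : Function.Surjective q)
    (hv : ∀ A : Matrix (Fin 2) (Fin 2) ℝ, ∃ v, φ v = A ∧ p v = 0 ∧
      (A 1 0 + A 0 1 = 0 → A 1 1 - A 0 0 = 0 → q v = 0))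
    (hF : ∀ v, F v = 0 → p v = 0 ∧ φ v 1 0 + φ v 0 1 = 0 ∧ φ v 1 1 - φ v 0 0 = 0) :
    (∀ v, q v = 0 ↔ F v = 0) ∧ Function.Surjective F := by
  haveI : FiniteDimensional ℝ T := Module.finite_of_finrank_pos (by omega)
  haveI : FiniteDimensional ℝ X := Module.finite_of_finrank_pos (by omega)
  haveI : FiniteDimensional ℝ Y := Module.finite_of_finrank_pos (by omega)
  haveI : FiniteDimensional ℝ G := Module.finite_of_finrank_pos (by omega)
  have rp := p.finrank_range_add_finrank_ker
  rw [LinearMap.range_eq_top.2 hp, finrank_top, hX, hT] at rp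
  have rq := q.finrank_range_add_finrank_ker
  rw [LinearMap.range_eq_top.2 hq, finrank_top, hY, hT] at rq
  have rF := F.finrank_range_add_finrank_ker
  rw [hT] at rF
  have hFle : Module.finrank ℝ (LinearMap.range F) ≤ k + 3 := hG ▸ Submodule.finrank_le _
  have hsurj : Function.Surjective (φ ∘ₗ (LinearMap.ker p).subtype) := fun A => by
    obtain ⟨v, h1, h2, -⟩ := hv A
    exact ⟨⟨v, h2⟩, h1⟩
  have hinj : Function.Injective (φ ∘ₗ (LinearMap.ker p).subtype) :=
    (LinearMap.injective_iff_surjective_of_finrank_eq_finrank (by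
      rw [Module.finrank_matrix]; simp; omega)).2 hsurj
  have hle : LinearMap.ker F ≤ LinearMap.ker q := fun v h => by
    obtain ⟨h1, h2, h3⟩ := hF v h
    obtain ⟨w, w1, w2, w3⟩ := hv (φ v)
    have e : (⟨w, w2⟩ : LinearMap.ker p) = ⟨v, h1⟩ := hinj w1
    have e' : w = v := congrArg Subtype.val e
    exact e' ▸ w3 h2 h3
  have heq : LinearMap.ker F = LinearMap.ker q :=
    Submodule.eq_of_le_of_finrank_le hle (by omega)
  refine ⟨fun v => by rw [← LinearMap.mem_ker, ← LinearMap.mem_ker, heq], ?_⟩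
  rw [← LinearMap.range_eq_top]
  refine Submodule.eq_top_of_finrank_eq ?_
  rw [heq] at rF
  omega

/-- The coefficients of the combination are the values of l on the standard basis vectors. -/
theorem exists_comp_pi_prod_iff_mem_span {T ι : Type*} [AddCommGroup T] [Module ℝ T] [Fintype ι]
    [DecidableEq ι] (x : ι → T →ₗ[ℝ] ℂ) (z β : T →ₗ[ℝ] ℂ) :
    (∃ l : ((ι → ℂ) × ℂ) →ₗ[ℂ] ℂ, β = l.restrictScalars ℝ ∘ₗ (LinearMap.pi x).prod z) ↔
      β ∈ Submodule.span ℂ (Set.range x ∪ {z}) := by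
  constructor
  · rintro ⟨l, rfl⟩
    have h : l.restrictScalars ℝ ∘ₗ (LinearMap.pi x).prod z
        = (∑ j, l (Pi.single j 1, 0) • x j) + l (0, 1) • z := by
      ext v
      have e : (fun j => x j v, z v)
          = (∑ j, x j v • ((Pi.single j 1, 0) : (ι → ℂ) × ℂ)) + z v • ((0, 1) : (ι → ℂ) × ℂ) := by
        refine Prod.ext ?_ ?_
        · funext i
          simp [Prod.fst_sum, Finset.sum_apply, Pi.single_apply]
        · simp [Prod.snd_sum]
      change l (fun j => x j v, z v) = _
      rw [e, map_add, map_sum, map_smul]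
      simp only [LinearMap.add_apply, LinearMap.sum_apply, LinearMap.smul_apply, map_smul,
        smul_eq_mul]
      simp only [mul_comm]
    rw [h]
    exact Submodule.add_mem _ (Submodule.sum_mem _ fun j _ => Submodule.smul_mem _ _
      (Submodule.subset_span (Or.inl ⟨j, rfl⟩))) (Submodule.smul_mem _ _
      (Submodule.subset_span (Or.inr rfl)))
  · intro h
    induction h using Submodule.span_induction with
    | mem y hy =>
      rcases hy with ⟨j, rfl⟩ | rfl
      · exact ⟨LinearMap.proj j ∘ₗ LinearMap.fst ℂ _ _, rfl⟩
      · exact ⟨LinearMap.snd ℂ _ _, rfl⟩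
    | zero => exact ⟨0, rfl⟩
    | add y y' _ _ h h' =>
      obtain ⟨l, rfl⟩ := h
      obtain ⟨l', rfl⟩ := h'
      exact ⟨l + l', rfl⟩
    | smul c y _ h =>
      obtain ⟨l, rfl⟩ := h
      exact ⟨c • l, rfl⟩

/-- The hypotheses say that A commutes with the quarter turn (0, -1; 1, 0); then so does exp A, and
the invertible matrices commuting with it form CO(2). -/
theorem expGL_mem_CO2 {A : Matrix (Fin 2) (Fin 2) ℝ} (h1 : A 1 0 + A 0 1 = 0)
    (h2 : A 1 1 - A 0 0 = 0) : expGL A ∈ CO2 := by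
  have hA : Commute !![(0 : ℝ), -1; 1, 0] A := by
    rw [Matrix.eta_fin_two A]
    change _ * _ = _ * _
    rw [Matrix.mul_fin_two, Matrix.mul_fin_two]
    ext i j
    fin_cases i <;> fin_cases j <;> simp <;> linarith
  have hB : !![(0 : ℝ), -1; 1, 0] * (expGL A).val = (expGL A).val * !![(0 : ℝ), -1; 1, 0] :=
    hA.exp_right
  rw [Matrix.eta_fin_two (expGL A).val, Matrix.mul_fin_two, Matrix.mul_fin_two] at hB
  have e1 := congrFun (congrFun hB 0) 0
  have e2 := congrFun (congrFun hB 0) 1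
  simp at e1 e2
  refine ⟨(expGL A).val 0 0, (expGL A).val 1 0, ?_⟩
  rw [Matrix.eta_fin_two (expGL A).val]
  ext i j
  fin_cases i <;> fin_cases j <;> simp <;> linarith

theorem expGL_zero : expGL 0 = 1 := Units.ext NormedSpace.exp_zero

end LinearAlgebra

/-! ### The forms ξ and ζ as a transverse coframe -/

section Coframe

variable {k : ℕ} {M : Type*} [TopologicalSpace M]
  [ChartedSpace (EuclideanSpace ℝ (Fin (k + 1))) M] [IsManifold (𝓡 (k + 1)) ∞ M]
  {E : M → Type*} [∀ p, AddCommGroup (E p)]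
  [∀ p, Module ℝ (E p)] [∀ p, TopologicalSpace (E p)] [TopologicalSpace (TotalSpace F2 E)]
  [FiberBundle F2 E] [VectorBundle ℝ F2 E] [ContMDiffVectorBundle ∞ F2 E (𝓡 (k + 1))]

theorem fundamentalCurve_zero (b : FrameBundle E) (A : Matrix (Fin 2) (Fin 2) ℝ) :
    fundamentalCurve b A 0 = b := by
  rw [fundamentalCurve, zero_smul, expGL_zero, FrameBundle.act_one]

/-- A map constant along a curve kills the velocity of the curve. -/
theorem mfderiv_mfderiv_eq_zero {V₁ H₁ V₂ H₂ : Type*} [NormedAddCommGroup V₁] [NormedSpace ℝ V₁]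
    [TopologicalSpace H₁] [NormedAddCommGroup V₂] [NormedSpace ℝ V₂] [TopologicalSpace H₂]
    {I₁ : ModelWithCorners ℝ V₁ H₁} {I₂ : ModelWithCorners ℝ V₂ H₂} {N₁ N₂ : Type*}
    [TopologicalSpace N₁] [ChartedSpace H₁ N₁] [TopologicalSpace N₂] [ChartedSpace H₂ N₂]
    {f : N₁ → N₂} {γ : ℝ → N₁} {t : ℝ} (hf : MDifferentiableAt I₁ I₂ f (γ t))
    {z : N₂} (h : ∀ s, f (γ s) = z) (r : ℝ) :
    mfderiv I₁ I₂ f (γ t) (mfderiv 𝓘(ℝ, ℝ) I₁ γ t r) = 0 := by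
  by_cases hγ : MDifferentiableAt 𝓘(ℝ, ℝ) I₁ γ t
  · have h1 := mfderiv_comp t hf hγ
    have h2 : f ∘ γ = fun _ => z := funext h
    rw [h2, mfderiv_const] at h1
    exact (DFunLike.congr_fun h1 r).symm
  -- A non-differentiable curve has velocity 0 by convention, so the differentiability of the
  -- fundamental curves never has to be proved.
  · rw [mfderiv_zero_of_not_mdifferentiableAt hγ]
    exact map_zero _

variable {φ : ∀ b : FrameBundle E, TangentSpace (modelB k) b →ₗ[ℝ] Matrix (Fin 2) (Fin 2) ℝ}
  [ChartedSpace (EuclideanSpace ℝ (Fin (k + 3))) (FrameQuotient E)]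

/-- The vector is the velocity of b · exp(tA): this curve stays over one point of M, and within one
CO(2)-orbit when A lies in co(2). -/
theorem exists_vertical (hφ : IsGL2Connection k φ)
    (hq : IsSmoothSubmersion (modelB k) (𝓡 (k + 3)) (frameProj E))
    (b : FrameBundle E) (A : Matrix (Fin 2) (Fin 2) ℝ) :
    ∃ v : TangentSpace (modelB k) b, φ b v = A ∧
      mfderiv (modelB k) (𝓡 (k + 1)) (fun c : FrameBundle E => c.1.proj) b v = 0 ∧
      (A 1 0 + A 0 1 = 0 → A 1 1 - A 0 0 = 0 →
        mfderiv (modelB k) (𝓡 (k + 3)) (frameProj E) b v = 0) := by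
  have h : ∃ v : TangentSpace (modelB k) (fundamentalCurve b A 0),
      φ (fundamentalCurve b A 0) v = A ∧
      mfderiv (modelB k) (𝓡 (k + 1)) (fun c : FrameBundle E => c.1.proj)
        (fundamentalCurve b A 0) v = 0 ∧
      (A 1 0 + A 0 1 = 0 → A 1 1 - A 0 0 = 0 →
        mfderiv (modelB k) (𝓡 (k + 3)) (frameProj E) (fundamentalCurve b A 0) v = 0) := by
    refine ⟨_, hφ.fundamental b A, ?_, fun h1 h2 => ?_⟩
    · exact mfderiv_mfderiv_eq_zero (f := fun c : FrameBundle E => c.1.proj)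
        (γ := fundamentalCurve b A) (mdifferentiable_frameBundle_proj (k := k) _)
        (z := b.1.proj) (fun s => rfl) 1
    · refine mfderiv_mfderiv_eq_zero (γ := fundamentalCurve b A) ((hq.contMDiff _).mdifferentiableAt (by simp))
        (z := frameProj E b) (fun s => frameProj_act b (expGL_mem_CO2 ?_ ?_)) 1
      · simp only [Matrix.smul_apply, ← smul_add, h1, smul_zero]
      · simp only [Matrix.smul_apply, ← smul_sub, h2, smul_zero]
  rwa [fundamentalCurve_zero] at h

/-- The forms `ξ^{k,j}` and `ζ`, as a single form with complex values. -/
def coframe (S : GL2Structure k M E) (hk : Odd k)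
    (φ : ∀ b : FrameBundle E, TangentSpace (modelB k) b →ₗ[ℝ] Matrix (Fin 2) (Fin 2) ℝ)
    (b : FrameBundle E) : TangentSpace (modelB k) b →ₗ[ℝ] (Idx k → ℂ) × ℂ :=
  (LinearMap.pi fun j => xi S hk j b).prod (zeta φ b)

theorem finrank_model (k : ℕ) :
    Module.finrank ℝ (EuclideanSpace ℝ (Fin (k + 1)) × (F2 × F2)) = k + 5 := by
  simp

/-- As k is odd there are (k + 1)/2 forms ξ, each of two real components; ζ adds two more. -/
theorem finrank_coframe (hk : Odd k) : Module.finrank ℝ ((Idx k → ℂ) × ℂ) = k + 3 := by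
  rw [Module.finrank_prod, Module.finrank_pi_fintype]
  simp only [Complex.finrank_real_complex, Finset.sum_const, Finset.card_univ, Fintype.card_fin,
    smul_eq_mul]
  obtain ⟨r, rfl⟩ := hk
  omega

/-- Together the ξ^{k,j} contain all the coordinates of the soldering form in the adapted basis, so
their vanishing makes the vector vertical. -/
theorem coframe_eq_zero {S : GL2Structure k M E} {hk : Odd k} {b : FrameBundle E}
    {v : TangentSpace (modelB k) b} (h : coframe S hk φ b v = 0) :
    mfderiv (modelB k) (𝓡 (k + 1)) (fun c : FrameBundle E => c.1.proj) b v = 0 ∧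
      φ b v 1 0 + φ b v 0 1 = 0 ∧ φ b v 1 1 - φ b v 0 0 = 0 := by
  have h1 : (fun j => xi S hk j b v) = 0 := congrArg Prod.fst h
  have h2 : zeta φ b v = 0 := congrArg Prod.snd h
  have h3 : solderingForm S b v = 0 := eq_zero_of_xiV hk fun j => congrFun h1 j
  refine ⟨?_, ?_⟩
  · exact ((S.iso b.1.proj).trans (polyEquiv k b.basis)).map_eq_zero_iff.1 h3
  · have h4 : ((φ b v 1 0 + φ b v 0 1 : ℝ) : ℂ)
        + Complex.I * ((φ b v 1 1 - φ b v 0 0 : ℝ) : ℂ) = 0 := h2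
    have h5 := Complex.ext_iff.1 h4
    simpa using h5

theorem contMDiff_coframe (S : GL2Structure k M E) (hk : Odd k) (hφ : IsGL2Connection k φ) :
    ContMDiff (modelB k).tangent 𝓘(ℝ, (Idx k → ℂ) × ℂ) ∞
      (fun v : TangentBundle (modelB k) (FrameBundle E) => coframe S hk φ v.proj v.snd) := by
  have h1 : ContMDiff (modelB k).tangent 𝓘(ℝ, ℂ) ∞
      (fun v : TangentBundle (modelB k) (FrameBundle E) => zeta φ v.proj v.snd) := by
    have hL : ContDiff ℝ ∞ fun x : ℝ × ℝ => (x.1 : ℂ) + Complex.I * (x.2 : ℂ) := by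
      have := Complex.ofRealCLM.contDiff (n := ∞)
      exact (this.comp contDiff_fst).add (contDiff_const.mul (this.comp contDiff_snd))
    exact hL.contMDiff.comp
      (((hφ.smooth 1 0).add (hφ.smooth 0 1)).prodMk_space ((hφ.smooth 1 1).sub (hφ.smooth 0 0)))
  exact (contMDiff_pi_space.2 fun j => contMDiff_xi S hk j).prodMk_space h1

theorem isTransverseCoframe_coframe (S : GL2Structure k M E) (hk : Odd k)
    (hφ : IsGL2Connection k φ) (hq : IsSmoothSubmersion (modelB k) (𝓡 (k + 3)) (frameProj E)) :
    IsTransverseCoframe (modelB k) (k + 3) (frameProj E) (coframe S hk φ) := by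
  have key := fun b : FrameBundle E =>
    ker_iff_and_surjective_of_vertical (k := k)
      (T := TangentSpace (modelB k) b) (X := TangentSpace (𝓡 (k + 1)) b.1.proj)
      (Y := TangentSpace (𝓡 (k + 3)) (frameProj E b)) (G := (Idx k → ℂ) × ℂ)
      (finrank_model k) finrank_euclideanSpace_fin finrank_euclideanSpace_fin (finrank_coframe hk)
      (p := (mfderiv (modelB k) (𝓡 (k + 1)) (fun c : FrameBundle E => c.1.proj) b).toLinearMap)
      (q := (mfderiv (modelB k) (𝓡 (k + 3)) (frameProj E) b).toLinearMap)
      (φ := φ b) (F := coframe S hk φ b) (surjective_mfderiv_frameBundle_proj b)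
      (hq.surjective_mfderiv b) (exists_vertical hφ hq b) (fun v hv => coframe_eq_zero hv)
  refine ⟨frameProj_surjective, hq, fun b => (key b).1, fun b => (key b).2, ?_⟩
  intro b b' hb
  obtain ⟨g, hg, rfl⟩ := frameProj_eq_iff.1 hb
  -- Two frames of one orbit are linked by a right translation, under which each component of F is
  -- multiplied by a complex constant.
  refine ⟨fun c => c.act g, rfl, funext fun c => frameProj_act c hg, mdifferentiable_act g b,
    surjective_mfderiv_act g b, fun w w' h => ?_⟩
  obtain ⟨u, v, hg⟩ := hg
  refine Prod.ext (funext fun j => ?_) ?_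
  · have h1 : xi S hk j (b.act g) (mfderiv (modelB k) (modelB k)
        (fun c : FrameBundle E => c.act g) b w') = Complex.I * xi S hk j (b.act g)
          (mfderiv (modelB k) (modelB k) (fun c : FrameBundle E => c.act g) b w) :=
      congrFun (congrArg Prod.fst h) j
    change xi S hk j b w' = Complex.I * xi S hk j b w
    rw [xi_act S hk j hg w', xi_act S hk j hg w, h1]
    ring
  · have h1 : zeta φ (b.act g) (mfderiv (modelB k) (modelB k)
        (fun c : FrameBundle E => c.act g) b w') = Complex.I * zeta φ (b.act g)
          (mfderiv (modelB k) (modelB k) (fun c : FrameBundle E => c.act g) b w) :=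
      congrArg Prod.snd h
    change zeta φ b w' = Complex.I * zeta φ b w
    rw [zeta_act hφ hg w', zeta_act hφ hg w, h1]
    ring

end Coframe

end GL2Geometry
end

/-! ### The canonical almost-complex structure -/

open scoped Manifold ContDiff Bundle
open GL2Geometry
theorem theorem1 (k : ℕ) (hk : Odd k)
    {M : Type*} [TopologicalSpace M] [ChartedSpace (EuclideanSpace ℝ (Fin (k + 1))) M]
    [IsManifold (𝓡 (k + 1)) ∞ M]
    (E : M → Type*) [∀ p, AddCommGroup (E p)] [∀ p, Module ℝ (E p)]
    [∀ p, TopologicalSpace (E p)] [TopologicalSpace (Bundle.TotalSpace F2 E)]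
    [FiberBundle F2 E] [VectorBundle ℝ F2 E] [ContMDiffVectorBundle ∞ F2 E (𝓡 (k + 1))]
    (S : GL2Structure k M E)
    (φ : ∀ b : FrameBundle E, TangentSpace (modelB k) b →ₗ[ℝ] Matrix (Fin 2) (Fin 2) ℝ)
    (hφ : IsGL2Connection k φ) :
    (∃ (_ : ChartedSpace (EuclideanSpace ℝ (Fin (k + 3))) (FrameQuotient E))
      (_ : IsManifold (𝓡 (k + 3)) ∞ (FrameQuotient E)),
      IsSmoothSubmersion (modelB k) (𝓡 (k + 3)) (frameProj E)) ∧
    ∀ [ChartedSpace (EuclideanSpace ℝ (Fin (k + 3))) (FrameQuotient E)]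
      [IsManifold (𝓡 (k + 3)) ∞ (FrameQuotient E)],
      IsSmoothSubmersion (modelB k) (𝓡 (k + 3)) (frameProj E) →
      ∃! J : ∀ z : FrameQuotient E, TangentSpace (𝓡 (k + 3)) z →ₗ[ℝ] TangentSpace (𝓡 (k + 3)) z,
        IsAlmostComplex J ∧
        ∀ (b : FrameBundle E) (β : TangentSpace (modelB k) b →ₗ[ℝ] ℂ),
          (∃ α : TangentSpace (𝓡 (k + 3)) (frameProj E b) →ₗ[ℝ] ℂ,
              IsOneZero J (frameProj E b) α ∧
              β = α ∘ₗ (mfderiv (modelB k) (𝓡 (k + 3)) (frameProj E) b).toLinearMap) ↔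
            β ∈ Submodule.span ℂ (Set.range (fun j => xi S hk j b) ∪ {zeta φ b}) := by 
  refine ⟨⟨frameQuotientChartedSpace k E, isManifold_frameQuotient k E,
    isSmoothSubmersion_frameProj⟩, fun {_} {_} hq => ?_⟩
  have hT := isTransverseCoframe_coframe S hk hφ hq
  have hspan := fun (b : FrameBundle E) (β : TangentSpace (modelB k) b →ₗ[ℝ] ℂ) =>
    exists_comp_pi_prod_iff_mem_span (fun j => xi S hk j b) (zeta φ b) β
  obtain ⟨J, hJ⟩ := hT.exists_isPushforward
  refine ⟨J, ⟨⟨hT.sq_eq_neg hJ, hT.contMDiff_pushforward (finrank_coframe hk)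
    (contMDiff_coframe S hk hφ) hJ⟩, fun b β => (hT.isOneZero_iff hJ b β).trans (hspan b β)⟩, ?_⟩
  -- Uniqueness uses only that the combinations of ξ and ζ are pullbacks of (1,0)-forms of J';
  -- neither J'² = -1 nor smoothness enters.
  rintro J' ⟨-, hJ'⟩
  exact hT.isPushforward_unique (fun b => hT.isPushforwardAt_of_isOneZero_iff fun β hβ =>
    (hJ' b β).2 ((hspan b β).1 hβ)) hJ
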